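/- **Setting.** Let $\Phi\subset\mathbb R^2$ be a simple, locally finite point process with law $P_\Phi$, let $\|\cdot\|$ be the Euclidean norm and $b(o,r)=\{x:\|x\|<r\}$. Each $x\in\Phi$ carries a fading variable $h_x$; given $\Phi$, the $h_x$ are i.i.d. with the law of a random variable $h$ with CDF $F_h$. The noise power is a constant $W\ge 0$, and the path loss is either $\ell(x)=(1+\|x\|^{\alpha})^{-1}$ (non-singular) or $\ell(x)=\|x\|^{-\alpha}$ (singular), with $\alpha>2$; $\ell(x)$ depends only on $\|x\|$ and is also written $\ell(\|x\|)$. The origin $o$ is served by the point $u$ of $\Phi$ nearest to $o$ (chosen uniformly at random among the nearest points if there are several), and $$\mathrm{SINR}=\frac{h_u\,\ell(u)}{W+\sum_{x\in\Phi\setminus\{u\}}h_x\ell(x)},\qquad P_c(\theta)=\mathbb P(\mathrm{SINR}>\theta).$$ Let $\xi=\min_{x\in\Phi}\|x\|$ be the contact distance. For $\zeta\ne o$ let $\Phi^\zeta$ be $\Phi$ conditioned on $\zeta\in\Phi$ (the Palm distribution at $\zeta$), and let $\Phi_o^\zeta$ be $\Phi$ conditioned on $\zeta$ being its nearest point to $o$,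 i.e. $\Phi^\zeta$ conditioned on $\Phi^\zeta(b(o,\|\zeta\|))=0$. Put $$I(\Phi_o^\zeta)=\sum_{x\in\Phi_o^\zeta\setminus\{\zeta\}}h_x\ell(x),\qquad \hat I^{\zeta}=\sum_{x\in\Phi^\zeta\setminus(\{\zeta\}\cup b(o,\|\zeta\|/2))}h_x\ell(x).$$ **The class $\mathcal A$.** $P_\Phi\in\mathcal A$ means that $\Phi$ is stationary, isotropic and mixing, and that 1. for every $n\ge 2$ the $n$th factorial moment measure of $\Phi$ has a bounded density with respect to Lebesgue measure; 2. for every $y>0$ there is $\zeta$ with $\|\zeta\|=y$ and $\mathbb P(\Phi^\zeta(b(o,y))=0)\neq 0$; 3. there is $y_0>0$ such that $\mathbb P(I(\Phi_o^\zeta)>z)\le\mathbb P(\hat I^{\zeta}>z)$ for all $\zeta$ with $\|\zeta\|>y_0$ and all $z\ge0$ (for the given fading and path loss); 4. $\mathbb E(\xi^n)<\infty$ for every $n\in\mathbb N$. **Theorem.** Let $P_\Phi\in\mathcal A$, and suppose that $F_h(t)\sim a\,t^m$ as $t\downarrow0$ for constants $a>0$ and $m\in(0,\infty)$, and that $\mathbb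 E(h^n)<\infty$ for all $n\in\mathbb N$. Then $\xi$ has a density $f_\xi$, and $$\frac{1-P_c(\theta)}{\theta^m}\longrightarrow\kappa\quad\text{as }\theta\downarrow0,\qquad \kappa=\int_0^\infty\mathbb E\Big[a\,\ell(y)^{-m}\big(I(\Phi_o^\zeta)+W\big)^m\Big]f_\xi(y)\,dy,$$ where $\zeta$ is any point with $\|\zeta\|=y$, and $0<\kappa<\infty$. This holds for both path loss models. -/

import Mathlib

open MeasureTheory ProbabilityTheory Filter Topology Asymptotics
open scoped ENNReal NNReal

noncomputable section

namespace Cellular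

/-- The Euclidean plane. -/
abbrev Plane := EuclideanSpace ℝ (Fin 2)

/-! ### Point processes -/

/-- A locally finite point pattern in the plane. -/
@[ext]
structure Config where
  carrier : Set Plane
  locallyFinite : ∀ B : Set Plane, Bornology.IsBounded B → (carrier ∩ B).Finite

namespace Config

/-- The number of points of `φ` in `B`. -/
def count (φ : Config) (B : Set Plane) : ℕ∞ := (φ.carrier ∩ B).encard

/-- The σ-algebra generated by the counts `φ ↦ φ(B)`, for `B` Borel. -/
instance : MeasurableSpace Config :=
  MeasurableSpace.generateFrom
    {Y | ∃ B : Set Plane, MeasurableSet B ∧ ∃ n : ℕ, Y = {φ | φ.count B = (n : ℕ∞)}}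

/-- The image of a pattern under a motion of the plane. -/
def move (e : Plane ≃ᵢ Plane) (φ : Config) : Config where
  carrier := e '' φ.carrier
  locallyFinite B hB := by
    have h : e '' φ.carrier ∩ B = e '' (φ.carrier ∩ e ⁻¹' B) := Set.image_inter_preimage _ _ _ |>.symm
    rw [h]
    refine (φ.locallyFinite _ ?_).image _
    rw [← e.image_symm]
    exact e.symm.isometry.lipschitz.isBounded_image hB

/-- The pattern `φ + v`. -/
def shift (v : Plane) (φ : Config) : Config := φ.move (IsometryEquiv.addRight v)

/-- The contact distance `ξ`: the distance from the origin to the nearest point of the pattern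
(`∞` if the pattern is empty). -/
def contactDist (φ : Config) : ℝ≥0∞ := Metric.infEDist 0 φ.carrier

/-- The points of `φ` that are nearest to the origin. -/
def nearest (φ : Config) : Set φ.carrier := {u | ∀ v : φ.carrier, ‖(u : Plane)‖ ≤ ‖(v : Plane)‖}

end Config

/-- The law `P` of a point process is stationary. -/
def IsStationary (P : Measure Config) : Prop :=
  ∀ (v : Plane) (Y : Set Config), MeasurableSet Y → P {φ | φ.shift v ∈ Y} = P Y

/-- The law `P` of a point process is invariant under rotations about the origin. -/
def IsIsotropic (P : Measure Config) : Prop :=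
  ∀ U : Plane ≃ₗᵢ[ℝ] Plane, LinearMap.det (U.toLinearEquiv : Plane →ₗ[ℝ] Plane) = 1 →
    ∀ Y : Set Config, MeasurableSet Y → P {φ | φ.move U.toIsometryEquiv ∈ Y} = P Y

/-- The law `P` of a (stationary) point process is mixing. -/
def IsMixing (P : Measure Config) : Prop :=
  ∀ Y Z : Set Config, MeasurableSet Y → MeasurableSet Z →
    Tendsto (fun v : Plane => P (Y ∩ {φ | φ.shift v ∈ Z})) (Bornology.cobounded Plane)
      (𝓝 (P Y * P Z))

/-- The `n`th factorial moment measure `α⁽ⁿ⁾(A)`: the mean number of `n`-tuples of distinct points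
of the process that lie in `A`. -/
def factorialMoment (P : Measure Config) (n : ℕ) (A : Set (Fin n → Plane)) : ℝ≥0∞ :=
  ∫⁻ φ : Config,
    (({x | Function.Injective x ∧ (∀ i, x i ∈ φ.carrier) ∧ x ∈ A} : Set (Fin n → Plane)).encard :
      ℝ≥0∞) ∂P

/-- `ρ` is an `n`th moment density of the process: a density of the `n`th factorial moment measure
with respect to Lebesgue measure. -/
def IsMomentDensity (P : Measure Config) (n : ℕ) (ρ : (Fin n → Plane) → ℝ≥0∞) : Prop :=
  Measurable ρ ∧ ∀ A, MeasurableSet A → factorialMoment P n A = ∫⁻ x in A, ρ x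

/-! ### Palm distributions and the conditional processes -/

/-- The unit square `[0,1)²`. -/
def unitSquare : Set Plane := {x | ∀ i, x i ∈ Set.Ico (0 : ℝ) 1}

/-- The intensity `λ`: the mean number of points per unit area. -/
def intensity (P : Measure Config) : ℝ≥0∞ := ∫⁻ φ : Config, (φ.count unitSquare : ℝ≥0∞) ∂P

/-- `𝔼[F(Φ^ζ)]`, where `Φ^ζ` is the stationary point process conditioned on `ζ ∈ Φ`, that is, under
the Palm distribution at `ζ`:
`𝔼[F(Φ^ζ)] = λ⁻¹ 𝔼[∑_{x ∈ Φ ∩ [0,1)²} F(Φ - x + ζ)]`. -/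
def palmExpect (P : Measure Config) (ζ : Plane) (F : Config → ℝ≥0∞) : ℝ≥0∞ :=
  (intensity P)⁻¹ *
    ∫⁻ φ : Config, ∑' x : ↥(φ.carrier ∩ unitSquare), F (φ.shift (ζ - (x : Plane))) ∂P

/-- The event that the open disk `b(o,‖ζ‖)` contains no point. -/
def emptyDisk (ζ : Plane) : Set Config := {φ | φ.count (Metric.ball 0 ‖ζ‖) = 0}

/-- `ℙ(Φ^ζ(b(o,‖ζ‖)) = 0)`. -/
def emptyDiskProb (P : Measure Config) (ζ : Plane) : ℝ≥0∞ :=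
  palmExpect P ζ ((emptyDisk ζ).indicator 1)

/-- `𝔼[F(Φ_o^ζ)]`, where `Φ_o^ζ` is the point process conditioned on `ζ` being its nearest point to
the origin, that is, `Φ^ζ` conditioned on having no point in `b(o,‖ζ‖)`. -/
def nearestExpect (P : Measure Config) (ζ : Plane) (F : Config → ℝ≥0∞) : ℝ≥0∞ :=
  palmExpect P ζ ((emptyDisk ζ).indicator F) / emptyDiskProb P ζ

/-! ### Path loss, fading, interference and SINR -/

/-- The non-singular path loss `ℓ(x) = (1 + ‖x‖^α)⁻¹`. -/
def nonsingularPathLoss (α : ℝ) (x : Plane) : ℝ≥0∞ := (1 + ‖x‖ₑ ^ α)⁻¹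

/-- The singular path loss `ℓ(x) = ‖x‖^(-α)`. -/
def singularPathLoss (α : ℝ) (x : Plane) : ℝ≥0∞ := ‖x‖ₑ ^ (-α)

/-- Given the pattern `φ`, the joint law of the fading variables `(h_x)_{x ∈ φ}`: they are
independent with common law `ν`. -/
def fadingLaw (ν : Measure ℝ) (φ : Config) : Measure (φ.carrier → ℝ) :=
  Measure.infinitePi fun _ => ν

open scoped Classical in
/-- The interference `∑ h_x ℓ(x)` from the points `x ≠ u` of `φ` with `‖x‖ ≥ r`. -/
def interference (ℓ : Plane → ℝ≥0∞) (φ : Config) (u : Plane) (r : ℝ) (h : φ.carrier → ℝ) : ℝ≥0∞ :=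
  ∑' x : φ.carrier,
    if (x : Plane) ≠ u ∧ r ≤ ‖(x : Plane)‖ then ENNReal.ofReal (h x) * ℓ x else 0

/-- The signal-to-interference-plus-noise ratio at the origin when it is served by `u ∈ φ`. -/
def sinr (ℓ : Plane → ℝ≥0∞) (W : ℝ≥0) (φ : Config) (u : φ.carrier) (h : φ.carrier → ℝ) : ℝ≥0∞ :=
  ENNReal.ofReal (h u) * ℓ u / (W + interference ℓ φ u 0 h)

/-- The success probability `P_c(θ) = ℙ(SINR > θ)` at the origin, which is served by the nearest
point of the process, chosen uniformly at random among the nearest points if there are several. -/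
def successProb (P : Measure Config) (ν : Measure ℝ) (ℓ : Plane → ℝ≥0∞) (W : ℝ≥0) (θ : ℝ) : ℝ≥0∞ :=
  ∫⁻ φ : Config,
    (∑' u : φ.nearest, fadingLaw ν φ {h | ENNReal.ofReal θ < sinr ℓ W φ u h}) /
      (φ.nearest.encard : ℝ≥0∞) ∂P

/-- `ℙ(I(Φ_o^ζ) > z)`: the tail of the total interference given that `ζ` is the nearest point. -/
def nearestInterferenceTail (P : Measure Config) (ν : Measure ℝ) (ℓ : Plane → ℝ≥0∞) (ζ : Plane)
    (z : ℝ≥0) : ℝ≥0∞ :=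
  nearestExpect P ζ fun φ => fadingLaw ν φ {h | (z : ℝ≥0∞) < interference ℓ φ ζ 0 h}

/-- The tail of the interference from the points of `Φ^ζ` other than `ζ` and outside
`b(o,‖ζ‖/2)`. -/
def palmInterferenceTail (P : Measure Config) (ν : Measure ℝ) (ℓ : Plane → ℝ≥0∞) (ζ : Plane)
    (z : ℝ≥0) : ℝ≥0∞ :=
  palmExpect P ζ fun φ => fadingLaw ν φ {h | (z : ℝ≥0∞) < interference ℓ φ ζ (‖ζ‖ / 2) h}

/-! ### The class of point process laws -/

/-- The class `𝒜` of laws of point processes, for fading with law `ν` and path loss `ℓ`. -/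
structure ClassA (ν : Measure ℝ) (ℓ : Plane → ℝ≥0∞) (P : Measure Config) : Prop where
  isProbability : IsProbabilityMeasure P
  stationary : IsStationary P
  isotropic : IsIsotropic P
  mixing : IsMixing P
  /-- All moment densities are bounded. -/
  momentDensity_bounded : ∀ n : ℕ, 2 ≤ n → ∃ ρ : (Fin n → Plane) → ℝ≥0∞,
    IsMomentDensity P n ρ ∧ ∃ q : ℝ≥0, ∀ x, ρ x < q
  /-- `ℙ(Φ^ζ(b(o,y)) = 0) ≠ 0` for some `ζ` with `‖ζ‖ = y`. -/
  emptyDisk_ne_zero : ∀ y : ℝ, 0 < y → ∃ ζ : Plane, ‖ζ‖ = y ∧ emptyDiskProb P ζ ≠ 0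
  /-- Stochastic dominance of the two interferences for large `‖ζ‖`. -/
  dominance : ∃ y₀ : ℝ, 0 < y₀ ∧ ∀ ζ : Plane, y₀ < ‖ζ‖ → ∀ z : ℝ≥0,
    nearestInterferenceTail P ν ℓ ζ z ≤ palmInterferenceTail P ν ℓ ζ z
  /-- All moments of the contact distance are finite. -/
  contactDist_moments : ∀ n : ℕ, ∫⁻ φ : Config, φ.contactDist ^ n ∂P < ∞

/-- The constant `κ = ∫_0^∞ 𝔼[a ℓ(y)^{-m} (I(Φ_o^ζ) + W)^m] f_ξ(y) dy`, where `f_ξ` is the density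
of the contact distance and `ζ = ζ(y)` is a point with `‖ζ‖ = y`. -/
def kappa (P : Measure Config) (ν : Measure ℝ) (ℓ : Plane → ℝ≥0∞) (W : ℝ≥0) (a m : ℝ)
    (ζ : ℝ → Plane) : ℝ≥0∞ :=
  ∫⁻ y in Set.Ioi (0 : ℝ),
    nearestExpect P (ζ y) (fun φ =>
      ∫⁻ h, ENNReal.ofReal a * ℓ (ζ y) ^ (-m) * (interference ℓ φ (ζ y) 0 h + W) ^ m
        ∂fadingLaw ν φ) *
    pdf (fun φ : Config => φ.contactDist.toReal) P volume y

end Cellular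

end

/-!
# Asymptotics of the outage probability for nearest-point association

Let `u` be the nearest point of the process and put `R = (I + W) / ℓ(u)`, where `I` is the
interference from the other points. Service fails exactly when `h_u ≤ θ R`, and `h_u` is independent
of `R`, so `1 - P_c(θ) = 𝔼[F_h(θ R)]`. Since `F_h(t) ~ a t^m` at `0` and `F_h(t) ≤ C t^m` for all
`t > 0`, dominated convergence gives `(1 - P_c(θ)) / θ^m → a 𝔼[R^m]`, provided that `𝔼[R^m]` is
finite (`ClassA.tendsto_outage`). It remains to prove this finiteness and to identify the limit
with `kappa`.

*Finiteness* (`ClassA.lintegral_interferenceRatio_rpow_lt_top`). All points are at least as far from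
the origin as `u`, so for both path losses `ℓ(x) / ℓ(u)` and `1 / ℓ(u)` are at most a constant times
`1 + ‖u‖^α`, in the first case with the extra factor `(1 + ‖x‖)^(-α)`, which is bounded and
integrable (`pathLoss_div_le`). Hence `R ≤ (1 + ξ^α) (C J + W)`, with `ξ` the contact distance and
`J = ∑ h_x (1 + ‖x‖)^(-α)`. All moments of `ξ` are finite by assumption. Those of `J` are finite by
Jensen's inequality, first over the fading, then over the plane, because the number of points in the
unit square has finite moments of all orders: these are controlled by the factorial moment measures.

*Identification* (`ClassA.kappa_eq`). The Campbell–Mecke formula (`lintegral_palmSum`) turns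
integrals of Palm expectations over the plane into expectations of sums over the process. Applied to
the sum with the nearest point as its only term, it shows that the conditional expectations given
the nearest point, integrated against the law of that point, give the plain expectation. By isotropy
these conditional expectations depend only on the distance, so that the integral over the plane
becomes an integral against the density of `ξ` (`ClassA.lintegral_eq_lintegral_pdf`).

Expectations over the fading need a measurable dependence on the pattern, while the fading variables
are indexed by the pattern itself. Almost every pattern has infinitely many points at distinct
positive distances from the origin (`ClassA.ae_isGeneral`), and for such patterns the points are
enumerated by distance, so that the fading becomes one i.i.d. sequence (`lintegral_fadingLaw`).
-/

noncomputable section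

namespace Cellular

/-! ### Point patterns as counting measures -/

namespace Config

lemma countable (φ : Config) : φ.carrier.Countable := by
  have h : φ.carrier = ⋃ n : ℕ, φ.carrier ∩ Metric.ball 0 (n : ℝ) := by
    rw [← Set.inter_iUnion, Metric.iUnion_ball_nat, Set.inter_univ]
  rw [h]
  exact Set.countable_iUnion fun n => (φ.locallyFinite _ Metric.isBounded_ball).countable

instance (φ : Config) : Countable φ.carrier := φ.countable.to_subtype

/-- The pattern `φ` as a counting measure on the plane. -/
def points (φ : Config) : Measure Plane := Measure.count.restrict φ.carrier

lemma points_apply (φ : Config) {B : Set Plane} (hB : MeasurableSet B) :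
    φ.points B = (φ.count B : ℝ≥0∞) := by
  rw [points, Measure.restrict_apply hB,
    Measure.count_apply (hB.inter φ.countable.measurableSet), count, Set.inter_comm]

lemma lintegral_points (φ : Config) (f : Plane → ℝ≥0∞) :
    ∫⁻ x, f x ∂φ.points = ∑' x : φ.carrier, f x := by
  rw [points, lintegral_countable _ φ.countable]
  simp

lemma setLIntegral_points (φ : Config) {B : Set Plane} (hB : MeasurableSet B)
    (f : Plane → ℝ≥0∞) :
    ∫⁻ x in B, f x ∂φ.points = ∑' x : ↥(φ.carrier ∩ B), f x := by
  rw [points, Measure.restrict_restrict hB, Set.inter_comm,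
    lintegral_countable _ (φ.countable.mono Set.inter_subset_left)]
  simp

lemma lintegral_points_eq_single (φ : Config) {f : Plane → ℝ≥0∞} {u : Plane}
    (hu : u ∈ φ.carrier) (h : ∀ x ∈ φ.carrier, x ≠ u → f x = 0) :
    ∫⁻ x, f x ∂φ.points = f u := by
  rw [lintegral_points, tsum_eq_single (⟨u, hu⟩ : φ.carrier)]
  exact fun x hx => h x x.2 fun h' => hx (Subtype.ext h')

lemma lintegral_points_move (e : Plane ≃ᵢ Plane) (φ : Config) (f : Plane → ℝ≥0∞) :
    ∫⁻ x, f x ∂(φ.move e).points = ∫⁻ x, f (e x) ∂φ.points := by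
  rw [lintegral_points, lintegral_points]
  exact tsum_image f e.injective.injOn

lemma mem_carrier_shift {v x : Plane} {φ : Config} :
    x ∈ (φ.shift v).carrier ↔ x - v ∈ φ.carrier := by
  constructor
  · rintro ⟨y, hy, rfl⟩
    simpa using hy
  · intro h
    exact ⟨x - v, h, by simp⟩

lemma mem_carrier_move {e : Plane ≃ᵢ Plane} {x : Plane} {φ : Config} :
    x ∈ (φ.move e).carrier ↔ e.symm x ∈ φ.carrier := by
  constructor
  · rintro ⟨y, hy, rfl⟩
    simpa using hy
  · intro h
    exact ⟨e.symm x, h, by simp⟩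

lemma lintegral_points_shift (v : Plane) (φ : Config) (f : Plane → ℝ≥0∞) :
    ∫⁻ x, f x ∂(φ.shift v).points = ∫⁻ x, f (x + v) ∂φ.points :=
  lintegral_points_move _ φ f

lemma shift_shift (v w : Plane) (φ : Config) : (φ.shift v).shift w = φ.shift (v + w) := by
  ext x
  rw [mem_carrier_shift, mem_carrier_shift, mem_carrier_shift, sub_sub, add_comm w v]

lemma move_shift (U : Plane ≃ₗᵢ[ℝ] Plane) (v : Plane) (φ : Config) :
    (φ.move U.toIsometryEquiv).shift (U v) = (φ.shift v).move U.toIsometryEquiv := by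
  ext x
  rw [mem_carrier_shift, mem_carrier_move, mem_carrier_move, mem_carrier_shift]
  change U.symm (x - U v) ∈ _ ↔ U.symm x - v ∈ _
  simp

end Config

/-! ### Measurability of functionals of a point pattern -/

open Config

lemma measurable_count {B : Set Plane} (hB : MeasurableSet B) :
    Measurable fun φ : Config => φ.count B :=
  ENat.measurable_iff.2 fun n => MeasurableSpace.measurableSet_generateFrom ⟨B, hB, n, rfl⟩

lemma measurable_points : Measurable Config.points := by
  refine Measure.measurable_of_measurable_coe _ fun B hB => ?_
  simp_rw [fun φ : Config => φ.points_apply hB]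
  exact Measurable.of_discrete.comp (measurable_count hB)

lemma measurable_config {β : Type*} [MeasurableSpace β] {F : β → Config}
    (h : ∀ B, MeasurableSet B → Measurable fun b => (F b).points B) : Measurable F := by
  refine measurable_generateFrom ?_
  rintro _ ⟨B, hB, n, rfl⟩
  convert h B hB (measurableSet_singleton (n : ℝ≥0∞)) using 1
  ext b
  simp only [Set.mem_preimage, Set.mem_ofPred_eq, Set.mem_singleton_iff, points_apply _ hB]
  exact ⟨fun h => by rw [h]; simp, fun h => by exact_mod_cast h⟩

/-- The kernel that sends a point pattern to its counting measure. -/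
def pointsKernel : Kernel Config Plane := ⟨Config.points, measurable_points⟩

/-- The counting kernel is s-finite: cut the plane into annuli, and the space of patterns
according to the number of points in each annulus. -/
instance : IsSFiniteKernel pointsKernel := by
  classical
  let A : ℕ → Set Plane := fun k => {x | ⌊‖x‖⌋₊ = k}
  have hA : ∀ k, MeasurableSet (A k) := fun k =>
    (Nat.measurable_floor.comp measurable_norm) (measurableSet_singleton k)
  have hAb : ∀ k, Bornology.IsBounded (A k) := fun k =>
    Metric.isBounded_ball.subset fun x (hx : ⌊‖x‖⌋₊ = k) => by
      rw [mem_ball_zero_iff]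
      have := Nat.lt_floor_add_one ‖x‖
      rwa [hx] at this
  let S : ℕ → ℕ → Set Config := fun k j => {φ | φ.count (A k) = j}
  have hS : ∀ k j, MeasurableSet (S k j) := fun k j =>
    measurable_count (hA k) (measurableSet_singleton (j : ℕ∞))
  let K : ℕ × ℕ → Kernel Config Plane := fun p =>
    Kernel.piecewise (hS p.1 p.2) (pointsKernel.restrict (hA p.1)) 0
  have hK : ∀ p, IsFiniteKernel (K p) := by
    refine fun p => ⟨⟨p.2, by simp, fun φ => ?_⟩⟩
    simp only [K, Kernel.piecewise_apply]
    split_ifs with h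
    · rw [Kernel.restrict_apply, Measure.restrict_apply_univ]
      change φ.points _ ≤ _
      rw [points_apply _ (hA _), show φ.count (A p.1) = p.2 from h]
      simp
    · simp
  have hsum : pointsKernel = Kernel.sum K := by
    ext φ B hB
    rw [Kernel.sum_apply, Measure.sum_apply _ hB, ENNReal.tsum_prod']
    have hk : ∀ k, ∑' j, K (k, j) φ B = φ.points (B ∩ A k) := by
      intro k
      have hfin : (φ.carrier ∩ A k).Finite := φ.locallyFinite _ (hAb k)
      obtain ⟨j, hj⟩ := ENat.ne_top_iff_exists.1 (Set.encard_ne_top_iff.2 hfin)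
      rw [tsum_eq_single j]
      · have : φ ∈ S k j := hj.symm
        simp only [K, Kernel.piecewise_apply, this, if_true, Kernel.restrict_apply,
          Measure.restrict_apply hB]
        rfl
      · intro i hi
        have : φ ∉ S k i := fun h => hi (by
          have h' : (φ.carrier ∩ A k).encard = i := h
          rw [← hj] at h'
          exact_mod_cast h'.symm)
        simp [K, Kernel.piecewise_apply, this]
    simp_rw [hk]
    rw [← measure_iUnion]
    · rw [← Set.inter_iUnion]
      have : ⋃ k, A k = Set.univ := Set.eq_univ_of_forall fun x => Set.mem_iUnion.2 ⟨_, rfl⟩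
      rw [this, Set.inter_univ]
      rfl
    · intro i j hij
      refine Set.disjoint_left.2 fun x hx hx' => hij ?_
      exact (show ⌊‖x‖⌋₊ = i from hx.2).symm.trans hx'.2
    · exact fun k => hB.inter (hA k)
  rw [hsum]
  infer_instance

/-- A sum over the points of a pattern depends measurably on the pattern and on parameters. -/
lemma measurable_lintegral_points {β : Type*} [MeasurableSpace β] {F : β → Config}
    {g : β → Plane → ℝ≥0∞} (hF : Measurable F) (hg : Measurable (Function.uncurry g)) :
    Measurable fun b => ∫⁻ x, g b x ∂(F b).points :=
  Measurable.lintegral_kernel_prod_right (κ := pointsKernel.comap F hF) hg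

lemma measurable_shift : Measurable fun p : Plane × Config => p.2.shift p.1 := by
  refine measurable_config fun B hB => ?_
  have h : ∀ p : Plane × Config, (p.2.shift p.1).points B
      = ∫⁻ x, B.indicator 1 (x + p.1) ∂p.2.points := fun p => by
    rw [← lintegral_points_shift, lintegral_indicator_one hB]
  simp_rw [h]
  refine measurable_lintegral_points measurable_snd ?_
  exact (measurable_one.indicator hB).comp (by fun_prop : Measurable
    fun q : (Plane × Config) × Plane => q.2 + q.1.1)

lemma measurable_config_shift {β : Type*} [MeasurableSpace β] {F : β → Config} {v : β → Plane}
    (hF : Measurable F) (hv : Measurable v) : Measurable fun b => (F b).shift (v b) :=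
  measurable_shift.comp (hv.prodMk hF)

lemma measurable_move (e : Plane ≃ᵢ Plane) : Measurable fun φ : Config => φ.move e := by
  refine measurable_config fun B hB => ?_
  have h : ∀ φ : Config, (φ.move e).points B
      = ∫⁻ x, B.indicator 1 (e x) ∂φ.points := fun p => by
    rw [← lintegral_points_move, lintegral_indicator_one hB]
  simp_rw [h]
  exact measurable_lintegral_points measurable_id
    ((measurable_one.indicator hB).comp (e.continuous.measurable.comp measurable_snd))

lemma measurableSet_unitSquare : MeasurableSet unitSquare := by
  have : unitSquare = ⋂ i : Fin 2, (fun x : Plane => x i) ⁻¹' Set.Ico 0 1 := by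
    ext x; simp [unitSquare]
  rw [this]
  exact MeasurableSet.iInter fun i => (by fun_prop : Measurable fun x : Plane => x i)
    measurableSet_Ico

lemma volume_unitSquare : volume unitSquare = 1 := by
  have h := (EuclideanSpace.volume_preserving_symm_measurableEquiv_toLp (Fin 2)).symm
  have hU : unitSquare = (MeasurableEquiv.toLp 2 (Fin 2 → ℝ)).symm ⁻¹'
      (Set.univ.pi fun _ => Set.Ico (0 : ℝ) 1) := by
    ext x; simp [unitSquare, Set.mem_pi]
  rw [hU, (EuclideanSpace.volume_preserving_symm_measurableEquiv_toLp (Fin 2)).measure_preimage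
    (MeasurableSet.univ_pi fun _ => measurableSet_Ico).nullMeasurableSet, volume_pi_pi]
  simp

lemma norm_le_of_mem_unitSquare {x : Plane} (hx : x ∈ unitSquare) : ‖x‖ ≤ 2 := by
  rw [EuclideanSpace.norm_eq, Fin.sum_univ_two, Real.sqrt_le_left (by norm_num)]
  have h0 := hx 0
  have h1 := hx 1
  simp only [Real.norm_eq_abs, sq_abs]
  nlinarith [h0.1, h0.2, h1.1, h1.2]

lemma isBounded_unitSquare : Bornology.IsBounded unitSquare :=
  (Metric.isBounded_closedBall (x := (0 : Plane)) (r := 2)).subset fun _ hx =>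
    mem_closedBall_zero_iff.2 (norm_le_of_mem_unitSquare hx)

/-! ### The Campbell–Mecke formula -/

instance (φ : Config) : SFinite φ.points :=
  inferInstanceAs (SFinite (pointsKernel φ))

/-- The Palm expectation at `ζ` before normalization by the intensity: it obeys the Campbell–Mecke
formula whether or not the intensity is positive and finite. -/
def palmSum (P : Measure Config) (ζ : Plane) (F : Config → ℝ≥0∞) : ℝ≥0∞ :=
  ∫⁻ φ, ∫⁻ x in unitSquare, F (φ.shift (ζ - x)) ∂φ.points ∂P

lemma palmExpect_eq (P : Measure Config) (ζ : Plane) (F : Config → ℝ≥0∞) :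
    palmExpect P ζ F = (intensity P)⁻¹ * palmSum P ζ F := by
  simp_rw [palmExpect, palmSum, setLIntegral_points _ measurableSet_unitSquare]

lemma intensity_eq (P : Measure Config) : intensity P = ∫⁻ φ, φ.points unitSquare ∂P := by
  simp_rw [intensity, fun φ : Config => φ.points_apply measurableSet_unitSquare]

lemma palmSum_one (P : Measure Config) (ζ : Plane) : palmSum P ζ 1 = intensity P := by
  simp [palmSum, intensity_eq]

lemma palmSum_mono (P : Measure Config) (ζ : Plane) {F G : Config → ℝ≥0∞} (h : F ≤ G) :
    palmSum P ζ F ≤ palmSum P ζ G :=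
  lintegral_mono fun _ => lintegral_mono fun _ => h _

lemma measurable_palmSum (P : Measure Config) [SFinite P] {β : Type*} [MeasurableSpace β]
    {z : β → Plane} (hz : Measurable z) {f : β → Config → ℝ≥0∞}
    (hf : Measurable (Function.uncurry f)) :
    Measurable fun b => palmSum P (z b) (f b) := by
  refine Measurable.lintegral_prod_right' (f := fun p : β × Config =>
    ∫⁻ x in unitSquare, f p.1 (p.2.shift (z p.1 - x)) ∂p.2.points) ?_
  simp_rw [← lintegral_indicator measurableSet_unitSquare]
  refine measurable_lintegral_points measurable_snd ?_
  have : Measurable fun q : (β × Config) × Plane => f q.1.1 (q.1.2.shift (z q.1.1 - q.2)) :=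
    hf.comp ((measurable_fst.comp measurable_fst).prodMk
      (measurable_shift.comp ((((hz.comp measurable_fst).comp measurable_fst).sub
        measurable_snd).prodMk (measurable_snd.comp measurable_fst))))
  exact this.indicator (measurable_snd measurableSet_unitSquare)

lemma measurable_setLIntegral_shift (ζ : Plane) {F : Config → ℝ≥0∞} (hF : Measurable F) :
    Measurable fun φ : Config => ∫⁻ x in unitSquare, F (φ.shift (ζ - x)) ∂φ.points := by
  have hFs : Measurable fun p : Config × Plane => F (p.1.shift (ζ - p.2)) :=
    hF.comp (measurable_config_shift measurable_fst (measurable_snd.const_sub ζ))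
  simp_rw [← lintegral_indicator measurableSet_unitSquare]
  exact measurable_lintegral_points (g := fun φ : Config =>
    unitSquare.indicator fun x => F (φ.shift (ζ - x))) measurable_id
    (hFs.indicator (measurable_snd measurableSet_unitSquare))

lemma palmSum_const_mul (P : Measure Config) (ζ : Plane) (c : ℝ≥0∞) {F : Config → ℝ≥0∞}
    (hF : Measurable F) : palmSum P ζ (fun φ => c * F φ) = c * palmSum P ζ F := by
  rw [palmSum, palmSum, ← lintegral_const_mul _ (measurable_setLIntegral_shift ζ hF)]
  refine lintegral_congr fun φ => ?_
  have hφ : Measurable fun x => F (φ.shift (ζ - x)) :=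
    hF.comp (measurable_config_shift measurable_const (measurable_id.const_sub ζ))
  rw [← lintegral_const_mul _ hφ]

lemma IsStationary.lintegral_shift {P : Measure Config} (hP : IsStationary P) (v : Plane)
    {F : Config → ℝ≥0∞} (hF : Measurable F) : ∫⁻ φ, F (φ.shift v) ∂P = ∫⁻ φ, F φ ∂P := by
  have hm : Measurable fun φ : Config => φ.shift v :=
    measurable_shift.comp (measurable_const.prodMk measurable_id)
  have h : P.map (fun φ : Config => φ.shift v) = P := by
    ext Y hY
    rw [Measure.map_apply hm hY]
    exact hP v Y hY
  conv_rhs => rw [← h, lintegral_map hF hm]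

lemma IsIsotropic.lintegral_move {P : Measure Config} (hP : IsIsotropic P)
    (U : Plane ≃ₗᵢ[ℝ] Plane)
    (hU : LinearMap.det (U.toLinearEquiv : Plane →ₗ[ℝ] Plane) = 1)
    {F : Config → ℝ≥0∞} (hF : Measurable F) :
    ∫⁻ φ, F (φ.move U.toIsometryEquiv) ∂P = ∫⁻ φ, F φ ∂P := by
  have hm : Measurable fun φ : Config => φ.move U.toIsometryEquiv := measurable_move _
  have h : P.map (fun φ : Config => φ.move U.toIsometryEquiv) = P := by
    ext Y hY
    rw [Measure.map_apply hm hY]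
    exact hP U hU Y hY
  conv_rhs => rw [← h, lintegral_map hF hm]

/-- The Campbell–Mecke formula for a stationary point process. -/
theorem lintegral_palmSum {P : Measure Config} [SFinite P] (hP : IsStationary P)
    {f : Plane → Config → ℝ≥0∞} (hf : Measurable (Function.uncurry f)) :
    ∫⁻ z, palmSum P z (f z) = ∫⁻ φ, ∫⁻ x, f x φ ∂φ.points ∂P := by
  have hU := measurableSet_unitSquare
  have hf₁ : Measurable fun q : (Plane × Config) × Plane =>
      f q.1.1 (q.1.2.shift (q.1.1 - q.2)) :=
    hf.comp ((measurable_fst.comp measurable_fst).prodMk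
      (measurable_shift.comp (((measurable_fst.comp measurable_fst).sub measurable_snd).prodMk
        (measurable_snd.comp measurable_fst))))
  have hf₂ : Measurable fun q : (Plane × Config) × Plane =>
      f (q.1.1 + q.2) (q.1.2.shift q.1.1) :=
    hf.comp (((measurable_fst.comp measurable_fst).add measurable_snd).prodMk
      (measurable_shift.comp measurable_fst))
  have hf₃ : Measurable fun q : (Plane × Config) × Plane =>
      unitSquare.indicator (1 : Plane → ℝ≥0∞) (q.2 - q.1.1) * f q.2 q.1.2 :=
    ((measurable_one.indicator hU).comp (measurable_snd.sub
      (measurable_fst.comp measurable_fst))).mul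
        (hf.comp (measurable_snd.prodMk (measurable_snd.comp measurable_fst)))
  have hf₃' : Measurable fun p : Plane × Config =>
      ∫⁻ y, unitSquare.indicator 1 (y - p.1) * f y p.2 ∂p.2.points :=
    measurable_lintegral_points (g := fun (p : Plane × Config) y =>
      unitSquare.indicator 1 (y - p.1) * f y p.2) measurable_snd hf₃
  have sec : ∀ (φ : Config) {g : (Plane × Config) × Plane → ℝ≥0∞}, Measurable g →
      Measurable fun p : Plane × Plane => g ((p.1, φ), p.2) := fun φ g hg =>
    hg.comp ((measurable_fst.prodMk measurable_const).prodMk measurable_snd)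
  have int : ∀ {g : (Plane × Config) × Plane → ℝ≥0∞}, Measurable g →
      Measurable fun p : Plane × Config => ∫⁻ x in unitSquare, g (p, x) ∂p.2.points := by
    intro g hg
    simp_rw [← lintegral_indicator hU]
    exact measurable_lintegral_points measurable_snd (hg.indicator (measurable_snd hU))
  -- Substitute `z = v + x`, then use stationarity to replace `φ.shift v` by `φ`; the integral over
  -- `v` of the indicator of `y - v ∈ unitSquare` is the area of the square.
  calc ∫⁻ z, palmSum P z (f z)
      = ∫⁻ φ, (∫⁻ z, ∫⁻ x in unitSquare, f z (φ.shift (z - x)) ∂φ.points) ∂P :=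
        lintegral_lintegral_swap (int hf₁).aemeasurable
    _ = ∫⁻ φ, (∫⁻ v, ∫⁻ x in unitSquare, f (v + x) (φ.shift v) ∂φ.points) ∂P := by
        refine lintegral_congr fun φ => ?_
        have h₁ := lintegral_lintegral_swap (μ := volume) (ν := φ.points.restrict unitSquare)
          (f := fun z x => f z (φ.shift (z - x))) (sec φ hf₁).aemeasurable
        have h₂ := lintegral_lintegral_swap (μ := volume) (ν := φ.points.restrict unitSquare)
          (f := fun v x => f (v + x) (φ.shift v)) (sec φ hf₂).aemeasurable
        rw [h₁, h₂]
        refine lintegral_congr fun x => ?_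
        rw [← lintegral_add_right_eq_self _ x]
        simp
    _ = ∫⁻ v, ∫⁻ φ, (∫⁻ x in unitSquare, f (v + x) (φ.shift v) ∂φ.points) ∂P :=
        (lintegral_lintegral_swap (int hf₂).aemeasurable).symm
    _ = ∫⁻ v, ∫⁻ φ, (∫⁻ y, unitSquare.indicator 1 (y - v) * f y φ ∂φ.points) ∂P := by
        refine lintegral_congr fun v => ?_
        have hm : Measurable fun φ : Config =>
            ∫⁻ y, unitSquare.indicator 1 (y - v) * f y φ ∂φ.points :=
          hf₃'.comp measurable_prodMk_left
        rw [← hP.lintegral_shift v hm]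
        refine lintegral_congr fun φ => ?_
        rw [lintegral_points_shift, ← lintegral_indicator hU]
        refine lintegral_congr fun x => ?_
        by_cases hx : x ∈ unitSquare <;> simp [hx, add_comm]
    _ = ∫⁻ φ, (∫⁻ v, ∫⁻ y, unitSquare.indicator 1 (y - v) * f y φ ∂φ.points) ∂P :=
        lintegral_lintegral_swap hf₃'.aemeasurable
    _ = ∫⁻ φ, ∫⁻ x, f x φ ∂φ.points ∂P := by
        refine lintegral_congr fun φ => ?_
        have h₃ := lintegral_lintegral_swap (μ := volume) (ν := φ.points)
          (f := fun v y => unitSquare.indicator (1 : Plane → ℝ≥0∞) (y - v) * f y φ)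
          (sec φ hf₃).aemeasurable
        rw [h₃]
        refine lintegral_congr fun y => ?_
        have hm : Measurable fun v => unitSquare.indicator (1 : Plane → ℝ≥0∞) (y - v) :=
          (measurable_one.indicator hU).comp (measurable_const.sub measurable_id)
        rw [lintegral_mul_const _ hm,
          lintegral_sub_left_eq_self (unitSquare.indicator (1 : Plane → ℝ≥0∞)) y,
          lintegral_indicator_one hU, volume_unitSquare, one_mul]

/-- The unit square in the definition of the Palm distribution can be replaced by any weight. -/
lemma lintegral_weight_mul_shift {P : Measure Config} [SFinite P] (hP : IsStationary P)
    {w : Plane → ℝ≥0∞} (hw : Measurable w) (ζ : Plane) {F : Config → ℝ≥0∞}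
    (hF : Measurable F) :
    ∫⁻ φ, ∫⁻ x, w x * F (φ.shift (ζ - x)) ∂φ.points ∂P = (∫⁻ x, w x) * palmSum P ζ F := by
  have hFs : Measurable fun p : Plane × Config => F (p.2.shift (ζ - p.1)) :=
    hF.comp (measurable_config_shift measurable_snd (measurable_fst.const_sub ζ))
  have hwF : Measurable (Function.uncurry fun x (φ : Config) => w x * F (φ.shift (ζ - x))) :=
    Measurable.mul (hw.comp measurable_fst) hFs
  rw [← lintegral_palmSum (f := fun x φ => w x * F (φ.shift (ζ - x))) hP hwF,
    ← lintegral_mul_const _ hw]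
  refine lintegral_congr fun z => ?_
  rw [← palmSum_const_mul P ζ (w z) hF]
  simp only [palmSum, shift_shift, sub_add_sub_cancel']

/-- Palm distributions at points of equal norm are rotations of each other. -/
lemma palmSum_rotate {P : Measure Config} [SFinite P] (hP : IsStationary P)
    (hI : IsIsotropic P) (U : Plane ≃ₗᵢ[ℝ] Plane)
    (hU : LinearMap.det (U.toLinearEquiv : Plane →ₗ[ℝ] Plane) = 1) (ζ : Plane)
    {F : Config → ℝ≥0∞} (hF : Measurable F) :
    palmSum P (U ζ) F = palmSum P ζ fun φ => F (φ.move U.toIsometryEquiv) := by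
  have hw : Measurable fun y : Plane => unitSquare.indicator (1 : Plane → ℝ≥0∞) (U.symm y) :=
    (measurable_one.indicator measurableSet_unitSquare).comp U.symm.continuous.measurable
  have hw1 : ∫⁻ y : Plane, unitSquare.indicator (1 : Plane → ℝ≥0∞) (U.symm y) = 1 := by
    rw [U.symm.measurePreserving.lintegral_comp
      (measurable_one.indicator measurableSet_unitSquare),
      lintegral_indicator_one measurableSet_unitSquare, volume_unitSquare]
  have hFs : Measurable fun p : Config × Plane => F (p.1.shift (U ζ - p.2)) :=
    hF.comp (measurable_config_shift measurable_fst (measurable_snd.const_sub (U ζ)))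
  have h := lintegral_weight_mul_shift hP hw (U ζ) hF
  rw [hw1, one_mul] at h
  rw [← h, ← hI.lintegral_move U hU]
  · refine lintegral_congr fun φ => ?_
    rw [Config.lintegral_points_move, ← lintegral_indicator measurableSet_unitSquare]
    refine lintegral_congr fun x => ?_
    have hx : (U.toIsometryEquiv x : Plane) = U x := rfl
    rw [hx, ← map_sub, move_shift, U.symm_apply_apply]
    by_cases hxU : x ∈ unitSquare <;> simp [hxU]
  · exact measurable_lintegral_points (g := fun (φ : Config) x =>
      unitSquare.indicator 1 (U.symm x) * F (φ.shift (U ζ - x))) measurable_id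
      (Measurable.mul (hw.comp measurable_snd) hFs)

lemma exists_rotation {x y : Plane} (h : ‖x‖ = ‖y‖) :
    ∃ U : Plane ≃ₗᵢ[ℝ] Plane,
      LinearMap.det (U.toLinearEquiv : Plane →ₗ[ℝ] Plane) = 1 ∧ U x = y := by
  have : Fact (Module.finrank ℝ Plane = 2) := ⟨by simp⟩
  let o : Orientation ℝ Plane (Fin 2) := (EuclideanSpace.basisFun (Fin 2) ℝ).toBasis.orientation
  exact ⟨o.rotation (o.oangle x y), o.det_rotation _, (o.rotation_oangle_eq_iff_norm_eq x y).2 h⟩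

/-- The image of a Lebesgue-null set of radii is null. -/
lemma volume_norm_preimage_eq_zero {N : Set ℝ} (h : volume N = 0) :
    volume {z : Plane | ‖z‖ ∈ N} = 0 := by
  have : Nontrivial Plane := inferInstance
  have hf : Integrable (fun z : Plane => N.indicator (1 : ℝ → ℝ) ‖z‖) := by
    rw [integrable_fun_norm_addHaar (volume : Measure Plane)]
    refine Integrable.congr (integrable_zero ℝ ℝ _) ?_
    have : ∀ᵐ y : ℝ, y ∉ N := measure_eq_zero_iff_ae_notMem.1 h
    filter_upwards [ae_restrict_of_ae this] with y hy
    simp [hy]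
  have h0 : ∫ z : Plane, N.indicator (1 : ℝ → ℝ) ‖z‖ = 0 := by
    rw [integral_fun_norm_addHaar]
    have : ∀ᵐ y : ℝ, y ∉ N := measure_eq_zero_iff_ae_notMem.1 h
    rw [integral_eq_zero_of_ae]
    · simp
    · filter_upwards [ae_restrict_of_ae this] with y hy
      simp [hy]
  rw [integral_eq_zero_iff_of_nonneg (fun z => Set.indicator_nonneg (by simp) _) hf] at h0
  rw [measure_eq_zero_iff_ae_notMem]
  filter_upwards [h0] with z hz hzN
  have hzN' : ‖z‖ ∈ N := hzN
  simp [hzN'] at hz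

/-! ### Enumeration of a pattern by distance from the origin -/

/-- A pattern in general position with respect to the origin: it has infinitely many points, none
of them at the origin, and their distances from the origin are distinct. -/
structure Config.IsGeneral (φ : Config) : Prop where
  infinite : φ.carrier.Infinite
  zero_notMem : (0 : Plane) ∉ φ.carrier
  injOn_norm : Set.InjOn (fun x : Plane => ‖x‖) φ.carrier

lemma Config.count_eq_zero {φ : Config} {B : Set Plane} :
    φ.count B = 0 ↔ ∀ x ∈ φ.carrier, x ∉ B := by
  rw [count, Set.encard_eq_zero, Set.eq_empty_iff_forall_notMem]
  exact forall_congr' fun x => by simp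

lemma measurableSet_injOn_norm :
    MeasurableSet {φ : Config | Set.InjOn (fun x : Plane => ‖x‖) φ.carrier} := by
  -- Norms are distinct if and only if the number `D φ` of pairs of equal norm vanishes.
  let T : Set (Plane × Plane) := {p | p.1 ≠ p.2 ∧ ‖p.1‖ = ‖p.2‖}
  have hT : MeasurableSet T :=
    (measurableSet_eq_fun measurable_fst measurable_snd).compl.inter
      (measurableSet_eq_fun measurable_fst.norm measurable_snd.norm)
  have hTi : Measurable (T.indicator (1 : Plane × Plane → ℝ≥0∞)) := measurable_one.indicator hT
  let D : Config → ℝ≥0∞ := fun φ => ∫⁻ x, ∫⁻ y, T.indicator 1 (x, y) ∂φ.points ∂φ.points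
  have hD : Measurable D := by
    refine measurable_lintegral_points measurable_id ?_
    exact measurable_lintegral_points (β := Config × Plane)
      (g := fun p y => T.indicator 1 (p.2, y)) measurable_fst
      (hTi.comp ((measurable_snd.comp measurable_fst).prodMk measurable_snd))
  convert hD (measurableSet_singleton 0) using 1
  ext φ
  simp only [D, Set.mem_ofPred_eq, Set.mem_preimage, Set.mem_singleton_iff, lintegral_points,
    ENNReal.tsum_eq_zero, Subtype.forall]
  constructor
  · intro h x hx y hy
    exact Set.indicator_of_notMem (fun hT : (x, y) ∈ T => hT.1 (h hx hy hT.2)) _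
  · intro h x hx y hy hxy
    by_contra hne
    have := h x hx y hy
    rw [Set.indicator_of_mem (show (x, y) ∈ T from ⟨hne, hxy⟩)] at this
    exact one_ne_zero this

lemma Config.count_singleton_zero {φ : Config} :
    φ.count {0} = 0 ↔ (0 : Plane) ∉ φ.carrier := by
  rw [count_eq_zero]
  exact ⟨fun h h0 => h 0 h0 rfl, fun h x hx hx0 => h (hx0 ▸ hx)⟩

lemma Config.count_univ_eq_top {φ : Config} :
    φ.count Set.univ = ⊤ ↔ φ.carrier.Infinite := by
  rw [count, Set.inter_univ, Set.encard_eq_top_iff]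

lemma measurableSet_isGeneral : MeasurableSet {φ : Config | φ.IsGeneral} := by
  have h : {φ : Config | φ.IsGeneral} = ({φ | φ.count Set.univ = ⊤} ∩ {φ | φ.count {0} = 0}) ∩
      {φ | Set.InjOn (fun x : Plane => ‖x‖) φ.carrier} := by
    ext φ
    exact ⟨fun h => ⟨⟨count_univ_eq_top.2 h.1, count_singleton_zero.2 h.2⟩, h.3⟩,
      fun h => ⟨count_univ_eq_top.1 h.1.1, count_singleton_zero.1 h.1.2, h.2⟩⟩
  rw [h]
  exact ((measurable_count .univ (measurableSet_singleton _)).inter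
    (measurable_count (measurableSet_singleton 0) (measurableSet_singleton _))).inter
      measurableSet_injOn_norm

/-- The points of a pattern in general position, in order of increasing norm. -/
lemma Config.IsGeneral.exists_equiv {φ : Config} (hφ : φ.IsGeneral) :
    ∃ e : ℕ ≃ φ.carrier, ∀ n, φ.count (Metric.ball 0 ‖(e n : Plane)‖) = n := by
  let r : Plane → ℕ := fun x => (φ.carrier ∩ Metric.ball 0 ‖x‖).ncard
  have hfin : ∀ x : Plane, (φ.carrier ∩ Metric.ball 0 ‖x‖).Finite := fun x =>
    φ.locallyFinite _ Metric.isBounded_ball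
  have hlt : ∀ x ∈ φ.carrier, ∀ y, ‖x‖ < ‖y‖ → r x < r y := by
    intro x hx y hxy
    refine Set.ncard_lt_ncard ?_ (hfin y)
    refine ⟨Set.inter_subset_inter_right _ (Metric.ball_subset_ball hxy.le), fun h => ?_⟩
    have := (h ⟨hx, by simpa using hxy⟩).2
    simp at this
  have hinj : Set.InjOn r φ.carrier := by
    intro x hx y hy hxy
    refine hφ.injOn_norm hx hy ?_
    by_contra hne
    rcases lt_or_gt_of_ne hne with h | h
    · exact (hlt x hx y h).ne hxy
    · exact (hlt y hy x h).ne' hxy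
  have hsurj : ∀ k, ∃ x ∈ φ.carrier, r x = k := by
    intro k
    obtain ⟨_, ⟨y, hy, rfl⟩, hk⟩ := (hφ.infinite.image hinj).exists_gt k
    have hsub : r '' (φ.carrier ∩ Metric.ball 0 ‖y‖) ⊆ Set.Iio (r y) := by
      rintro _ ⟨x, hx, rfl⟩
      exact hlt x hx.1 y (by simpa using hx.2)
    -- `r` maps the `r y` points closer than `y` injectively into `{0, …, r y - 1}`, hence onto it.
    have heq := Set.eq_of_subset_of_ncard_le hsub (by
      rw [Set.InjOn.ncard_image (hinj.mono Set.inter_subset_left)]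
      simp [r])
    obtain ⟨x, hx, hxk⟩ : k ∈ r '' (φ.carrier ∩ Metric.ball 0 ‖y‖) := heq ▸ hk
    exact ⟨x, hx.1, hxk⟩
  have hbij : Function.Bijective fun x : φ.carrier => r x :=
    ⟨fun x y h => Subtype.ext (hinj x.2 y.2 h), fun k => by
      obtain ⟨x, hx, h⟩ := hsurj k
      exact ⟨⟨x, hx⟩, h⟩⟩
  refine ⟨(Equiv.ofBijective _ hbij).symm, fun n => ?_⟩
  have h : r ((Equiv.ofBijective _ hbij).symm n) = n :=
    (Equiv.ofBijective _ hbij).apply_symm_apply n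
  rw [count, ← (hfin _).cast_ncard_eq]
  exact_mod_cast h

/-- The value of `f` at the point of `φ` that has exactly `n` points of `φ` closer to the origin.
It is written as a sum over the points, which makes it measurable in `φ`; if there are several or no
such points, it is the sum of the values at all of them. -/
def ranked (f : Plane → ℝ≥0∞) (n : ℕ) (φ : Config) : ℝ≥0∞ :=
  ∫⁻ x, {x : Plane | φ.count (Metric.ball 0 ‖x‖) = n}.indicator f x ∂φ.points

lemma measurableSet_rank (n : ℕ) :
    MeasurableSet {p : Config × Plane | p.1.count (Metric.ball 0 ‖p.2‖) = n} := by
  have hT : MeasurableSet {p : Plane × Plane | ‖p.2‖ < ‖p.1‖} :=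
    measurableSet_lt measurable_snd.norm measurable_fst.norm
  have hm : Measurable fun p : Config × Plane => p.1.points (Metric.ball 0 ‖p.2‖) := by
    have h : ∀ p : Config × Plane, p.1.points (Metric.ball 0 ‖p.2‖)
        = ∫⁻ y, {p : Plane × Plane | ‖p.2‖ < ‖p.1‖}.indicator 1 (p.2, y) ∂p.1.points := by
      intro p
      rw [← lintegral_indicator_one measurableSet_ball]
      refine lintegral_congr fun y => ?_
      simp [Set.indicator]
    simp_rw [h]
    exact measurable_lintegral_points (β := Config × Plane)
      (g := fun p y => {p : Plane × Plane | ‖p.2‖ < ‖p.1‖}.indicator 1 (p.2, y)) measurable_fst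
      ((measurable_one.indicator hT).comp
        ((measurable_snd.comp measurable_fst).prodMk measurable_snd))
  convert hm (measurableSet_singleton (n : ℝ≥0∞)) using 1
  ext p
  simp only [Set.mem_preimage, Set.mem_ofPred_eq, Set.mem_singleton_iff,
    points_apply _ measurableSet_ball]
  exact ⟨fun h => by rw [h]; simp, fun h => by exact_mod_cast h⟩

lemma measurable_ranked {f : Plane → ℝ≥0∞} (hf : Measurable f) (n : ℕ) :
    Measurable (ranked f n) := by
  refine measurable_lintegral_points (g := fun (φ : Config) x =>
    {x : Plane | φ.count (Metric.ball 0 ‖x‖) = n}.indicator f x) measurable_id ?_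
  exact (hf.comp measurable_snd).indicator (measurableSet_rank n)

section Enumeration

variable {φ : Config} {e : ℕ ≃ φ.carrier}

lemma rank_eq_iff (he : ∀ n, φ.count (Metric.ball 0 ‖(e n : Plane)‖) = n) {x : Plane}
    (hx : x ∈ φ.carrier) (n : ℕ) : φ.count (Metric.ball 0 ‖x‖) = n ↔ x = e n := by
  constructor
  · intro h
    obtain ⟨k, hk⟩ := e.surjective ⟨x, hx⟩
    have hk' : (e k : Plane) = x := congrArg Subtype.val hk
    have := he k
    rw [hk', h] at this
    rw [← hk', Nat.cast_injective this]
  · rintro rfl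
    exact he n

lemma ranked_eq (he : ∀ n, φ.count (Metric.ball 0 ‖(e n : Plane)‖) = n)
    (f : Plane → ℝ≥0∞) (n : ℕ) : ranked f n φ = f (e n) := by
  rw [ranked, φ.lintegral_points_eq_single (e n).2]
  · exact Set.indicator_of_mem (s := {x : Plane | φ.count (Metric.ball 0 ‖x‖) = n}) (he n) f
  · exact fun x hx hne => Set.indicator_of_notMem
      (s := {x : Plane | φ.count (Metric.ball 0 ‖x‖) = n})
      (fun h => hne ((rank_eq_iff he hx n).1 h)) f

lemma norm_le_of_enumeration (he : ∀ n, φ.count (Metric.ball 0 ‖(e n : Plane)‖) = n)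
    {x : Plane} (hx : x ∈ φ.carrier) : ‖(e 0 : Plane)‖ ≤ ‖x‖ := by
  by_contra h
  exact count_eq_zero.1 (he 0) x hx (by simpa using h)

lemma contactDist_eq (he : ∀ n, φ.count (Metric.ball 0 ‖(e n : Plane)‖) = n) :
    φ.contactDist = ‖(e 0 : Plane)‖ₑ := by
  refine le_antisymm ?_ ?_
  · refine (Metric.infEDist_le_edist_of_mem (e 0).2).trans ?_
    rw [edist_zero_left, enorm_eq_nnnorm]
  · refine Metric.le_infEDist.2 fun x hx => ?_
    rw [edist_zero_left, enorm_eq_nnnorm, ENNReal.coe_le_coe]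
    exact norm_le_of_enumeration he hx

lemma nearest_eq (hφ : φ.IsGeneral) (he : ∀ n, φ.count (Metric.ball 0 ‖(e n : Plane)‖) = n) :
    φ.nearest = {e 0} := by
  ext u
  simp only [nearest, Set.mem_ofPred_eq, Set.mem_singleton_iff]
  constructor
  · intro h
    exact Subtype.ext (hφ.injOn_norm u.2 (e 0).2
      ((h (e 0)).antisymm (norm_le_of_enumeration he u.2)))
  · rintro rfl v
    exact norm_le_of_enumeration he v.2

end Enumeration

/-! ### Fading marks along the enumeration -/

/-- The law of an i.i.d. sequence of fading variables. -/
def markLaw (ν : Measure ℝ) : Measure (ℕ → ℝ) := Measure.infinitePi fun _ => ν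

instance (ν : Measure ℝ) [IsProbabilityMeasure ν] : IsProbabilityMeasure (markLaw ν) :=
  inferInstanceAs (IsProbabilityMeasure (Measure.infinitePi _))

lemma measurable_natCases :
    Measurable (fun p n => Nat.casesOn n p.1 p.2 : ℝ × (ℕ → ℝ) → ℕ → ℝ) := by
  refine measurable_pi_lambda _ fun n => ?_
  cases n with
  | zero => exact measurable_fst
  | succ n => exact (measurable_pi_apply n).comp measurable_snd

/-- Prepending an independent variable to an i.i.d. sequence gives an i.i.d. sequence. -/
lemma map_cons_markLaw (ν : Measure ℝ) [IsProbabilityMeasure ν] :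
    (ν.prod (markLaw ν)).map (fun p n => Nat.casesOn n p.1 p.2 : ℝ × (ℕ → ℝ) → ℕ → ℝ)
      = markLaw ν := by
  refine Measure.eq_infinitePi _ fun s t ht => ?_
  rw [Measure.map_apply measurable_natCases (MeasurableSet.pi s.countable_toSet fun i _ => ht i)]
  let s' : Finset ℕ := s.preimage Nat.succ Nat.succ_injective.injOn
  have hs' : (markLaw ν) (Set.pi s' fun i => t (i + 1)) = ∏ i ∈ s', ν (t (i + 1)) :=
    Measure.infinitePi_pi _ fun i _ => ht _
  by_cases h0 : 0 ∈ s
  · have hpre : (fun p n => Nat.casesOn n p.1 p.2 : ℝ × (ℕ → ℝ) → ℕ → ℝ) ⁻¹' (Set.pi s t)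
        = t 0 ×ˢ Set.pi s' fun i => t (i + 1) := by
      ext p
      simp only [Set.mem_preimage, Set.mem_pi, Set.mem_prod, s', Finset.coe_preimage]
      exact ⟨fun h => ⟨h 0 h0, fun i hi => h (i + 1) hi⟩, fun h i hi => by
        cases i with
        | zero => exact h.1
        | succ i => exact h.2 i hi⟩
    have hs : s = insert 0 (s'.map ⟨Nat.succ, Nat.succ_injective⟩) := by
      ext i
      cases i <;> simp [s', h0]
    rw [hpre, Measure.prod_prod, hs', hs, Finset.prod_insert (by simp), Finset.prod_map]
    rfl
  · have hpre : (fun p n => Nat.casesOn n p.1 p.2 : ℝ × (ℕ → ℝ) → ℕ → ℝ) ⁻¹' (Set.pi s t)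
        = Set.univ ×ˢ Set.pi s' fun i => t (i + 1) := by
      ext p
      simp only [Set.mem_preimage, Set.mem_pi, Set.mem_prod, s', Finset.coe_preimage,
        Set.mem_univ, true_and]
      exact ⟨fun h i hi => h (i + 1) hi, fun h i hi => by
        cases i with
        | zero => exact absurd hi h0
        | succ i => exact h i hi⟩
    have hs : s = s'.map ⟨Nat.succ, Nat.succ_injective⟩ := by
      ext i
      cases i <;> simp [s', h0]
    rw [hpre, Measure.prod_prod, hs', measure_univ, one_mul]
    conv_rhs => rw [hs, Finset.prod_map]
    rfl

/-- The interference from all points but the nearest one, when the `n`th nearest of these has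
fading `h n`. -/
def rankedInterference (ℓ : Plane → ℝ≥0∞) (φ : Config) (h : ℕ → ℝ) : ℝ≥0∞ :=
  ∑' n, ENNReal.ofReal (h n) * ranked ℓ (n + 1) φ

lemma measurable_rankedInterference {ℓ : Plane → ℝ≥0∞} (hℓ : Measurable ℓ) :
    Measurable fun p : Config × (ℕ → ℝ) => rankedInterference ℓ p.1 p.2 :=
  Measurable.tsum fun n =>
    (ENNReal.measurable_ofReal.comp ((measurable_pi_apply n).comp measurable_snd)).mul
      ((measurable_ranked hℓ _).comp measurable_fst)

lemma measurable_rankedInterference_right (ℓ : Plane → ℝ≥0∞) (φ : Config) :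
    Measurable (rankedInterference ℓ φ) :=
  Measurable.tsum fun n =>
    (ENNReal.measurable_ofReal.comp (measurable_pi_apply n)).mul measurable_const

/-- The joint law of the fading of the nearest point and of the interference from the others. -/
lemma lintegral_fadingLaw (ν : Measure ℝ) [IsProbabilityMeasure ν] (ℓ : Plane → ℝ≥0∞)
    {φ : Config} {e : ℕ ≃ φ.carrier}
    (he : ∀ n, φ.count (Metric.ball 0 ‖(e n : Plane)‖) = n)
    {G : ℝ → ℝ≥0∞ → ℝ≥0∞} (hG : Measurable (Function.uncurry G)) :
    ∫⁻ h, G (h (e 0)) (interference ℓ φ (e 0) 0 h) ∂fadingLaw ν φ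
      = ∫⁻ t, ∫⁻ h, G t (rankedInterference ℓ φ h) ∂markLaw ν ∂ν := by
  have hmap : (fadingLaw ν φ).map (fun h n => h (e n)) = markLaw ν :=
    Measure.map_infinitePi_infinitePi_of_inj (P := fun _ : φ.carrier => ν) e.injective
  have hI : ∀ h : φ.carrier → ℝ, interference ℓ φ (e 0) 0 h
      = rankedInterference ℓ φ (fun n => h (e (n + 1))) := by
    intro h
    rw [interference, ← e.tsum_eq, tsum_eq_zero_add' ENNReal.summable]
    have hne : ∀ n, (e (n + 1) : Plane) ≠ e 0 := fun n h =>
      n.succ_ne_zero (e.injective (Subtype.ext h))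
    simp [rankedInterference, ranked_eq he, hne]
  let G' : (ℕ → ℝ) → ℝ≥0∞ := fun k => G (k 0) (rankedInterference ℓ φ fun n => k (n + 1))
  have hG' : Measurable G' := by
    have hs : Measurable fun (k : ℕ → ℝ) (n : ℕ) => k (n + 1) :=
      measurable_pi_lambda _ fun n => measurable_pi_apply (n + 1)
    exact hG.comp (f := fun k : ℕ → ℝ => (k 0, rankedInterference ℓ φ fun n => k (n + 1)))
      ((measurable_pi_apply 0).prodMk ((measurable_rankedInterference_right ℓ φ).comp hs))
  have hme : Measurable fun (h : φ.carrier → ℝ) (n : ℕ) => h (e n) :=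
    measurable_pi_lambda _ fun n => measurable_pi_apply (e n)
  simp_rw [hI]
  have h₁ : ∫⁻ h, G' (fun n => h (e n)) ∂fadingLaw ν φ = ∫⁻ k, G' k ∂markLaw ν := by
    rw [← hmap, lintegral_map hG' hme]
  refine h₁.trans ?_
  conv_lhs => rw [← map_cons_markLaw ν, lintegral_map hG' measurable_natCases]
  have hG'' : Measurable fun p : ℝ × (ℕ → ℝ) => G p.1 (rankedInterference ℓ φ p.2) :=
    hG.comp (measurable_fst.prodMk
      ((measurable_rankedInterference_right ℓ φ).comp measurable_snd))
  exact lintegral_prod _ hG''.aemeasurable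

/-! ### Moments of the number of points in the unit square -/

/-- A power of the number of points is controlled by the number of tuples of distinct points. -/
lemma count_pow_le (φ : Config) {B : Set Plane} (hB : Bornology.IsBounded B) (k : ℕ) :
    (φ.count B : ℝ≥0∞) ^ k ≤ (k : ℝ≥0∞) ^ k *
      (1 + (({x | Function.Injective x ∧ (∀ i, x i ∈ φ.carrier) ∧
        x ∈ Set.univ.pi fun _ => B} : Set (Fin k → Plane)).encard : ℝ≥0∞)) := by
  classical
  have hfin := φ.locallyFinite B hB
  let S : Set Plane := φ.carrier ∩ B
  have : Fintype S := hfin.fintype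
  let N := Fintype.card S
  have hN : φ.count B = N := by
    rw [count, Set.encard_eq_coe_toFinset_card, Set.toFinset_card]
  have henc : (N.descFactorial k : ℕ∞) ≤ ({x | Function.Injective x ∧ (∀ i, x i ∈ φ.carrier) ∧
        x ∈ Set.univ.pi fun _ => B} : Set (Fin k → Plane)).encard := by
    let ι : (Fin k ↪ S) → Fin k → Plane := fun f i => f i
    have hι : Function.Injective ι := fun f g h => by
      ext i
      exact congrArg (fun x : Plane => x _) (congrFun h i)
    have hr : Set.range ι ⊆ {x | Function.Injective x ∧ (∀ i, x i ∈ φ.carrier) ∧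
        x ∈ Set.univ.pi fun _ => B} := by
      rintro _ ⟨f, rfl⟩
      exact ⟨fun i j h => f.injective (Subtype.ext h), fun i => (f i).2.1, fun i _ => (f i).2.2⟩
    refine le_trans ?_ (Set.encard_le_encard hr)
    rw [← Set.image_univ, hι.encard_image, Set.encard_univ, ENat.card_eq_coe_fintype_card,
      Fintype.card_embedding_eq, Fintype.card_fin]
  have hpow : N ^ k ≤ k ^ k * (1 + N.descFactorial k) := by
    rcases lt_or_ge N k with h | h
    · exact (Nat.pow_le_pow_left h.le k).trans (Nat.le_mul_of_pos_right _ (by omega))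
    · have : N ^ k ≤ k ^ k * N.descFactorial k := by
        rw [Nat.descFactorial_eq_prod_range]
        calc N ^ k = ∏ _i ∈ Finset.range k, N := by simp
          -- If `i < k ≤ N`, then `N / (N - i) ≤ k`.
          _ ≤ ∏ i ∈ Finset.range k, k * (N - i) := by
            refine Finset.prod_le_prod' fun i hi => ?_
            have hi := Finset.mem_range.1 hi
            obtain ⟨d, hd⟩ := Nat.exists_eq_add_of_le h
            obtain ⟨j, rfl⟩ := Nat.exists_eq_add_of_lt hi
            have : N - i = j + 1 + d := by omega
            rw [this, hd]
            nlinarith [Nat.zero_le (i * j), Nat.zero_le (i * d), Nat.zero_le (j * d),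
              Nat.zero_le (j * j)]
          _ = _ := by rw [Finset.prod_mul_distrib]; simp
      refine this.trans (Nat.mul_le_mul_left _ (by omega))
  rw [hN]
  calc ((N : ℕ∞) : ℝ≥0∞) ^ k = ((N ^ k : ℕ) : ℝ≥0∞) := by simp
    _ ≤ ((k ^ k * (1 + N.descFactorial k) : ℕ) : ℝ≥0∞) := by exact_mod_cast hpow
    _ = (k : ℝ≥0∞) ^ k * (1 + ((N.descFactorial k : ℕ∞) : ℝ≥0∞)) := by push_cast; simp
    _ ≤ _ := by
      gcongr

section ClassA

variable {ν : Measure ℝ} {ℓ : Plane → ℝ≥0∞} {P : Measure Config}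

/-- The number of points in the unit square has finite moments of all orders. -/
lemma ClassA.lintegral_points_pow_lt_top (hP : ClassA ν ℓ P) (k : ℕ) :
    ∫⁻ φ, φ.points unitSquare ^ k ∂P < ∞ := by
  have := hP.isProbability
  have key : ∀ k, 2 ≤ k → ∫⁻ φ, φ.points unitSquare ^ k ∂P < ∞ := by
    intro k hk
    obtain ⟨ρ, hρ, q, hq⟩ := hP.momentDensity_bounded k hk
    have hm : MeasurableSet (Set.univ.pi fun _ : Fin k => unitSquare) :=
      MeasurableSet.univ_pi fun _ => measurableSet_unitSquare
    have hvol : volume (Set.univ.pi fun _ : Fin k => unitSquare) = 1 := by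
      rw [volume_pi_pi]
      simp [volume_unitSquare]
    have hfm : factorialMoment P k (Set.univ.pi fun _ => unitSquare) ≤ q := by
      rw [hρ.2 _ hm]
      calc ∫⁻ x in Set.univ.pi fun _ : Fin k => unitSquare, ρ x
          ≤ ∫⁻ _x in Set.univ.pi fun _ : Fin k => unitSquare, (q : ℝ≥0∞) :=
            lintegral_mono fun x => (hq x).le
        _ = q := by rw [setLIntegral_const, hvol, mul_one]
    calc ∫⁻ φ, φ.points unitSquare ^ k ∂P
        ≤ ∫⁻ φ : Config, (k : ℝ≥0∞) ^ k * (1 + (({x | Function.Injective x ∧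
            (∀ i, x i ∈ φ.carrier) ∧ x ∈ Set.univ.pi fun _ => unitSquare} :
              Set (Fin k → Plane)).encard : ℝ≥0∞)) ∂P := by
          refine lintegral_mono fun φ => ?_
          rw [points_apply _ measurableSet_unitSquare]
          exact count_pow_le φ isBounded_unitSquare k
      _ = (k : ℝ≥0∞) ^ k * (1 + factorialMoment P k (Set.univ.pi fun _ => unitSquare)) := by
          rw [lintegral_const_mul' _ _ (ENNReal.pow_ne_top (ENNReal.natCast_ne_top k)),
            lintegral_add_left measurable_const]
          simp [factorialMoment]
      _ < ∞ := ENNReal.mul_lt_top (ENNReal.pow_lt_top (ENNReal.natCast_lt_top k))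
          (ENNReal.add_lt_top.2 ⟨ENNReal.one_lt_top, hfm.trans_lt ENNReal.coe_lt_top⟩)
  rcases le_or_gt 2 k with hk | hk
  · exact key k hk
  · refine lt_of_le_of_lt (lintegral_mono (g := fun φ => 1 + φ.points unitSquare ^ 2)
      fun φ => ?_) ?_
    · rcases le_total (φ.points unitSquare) 1 with h | h
      · exact (pow_le_one' h k).trans le_self_add
      · exact (pow_le_pow_right₀ h hk.le).trans le_add_self
    · rw [lintegral_add_left measurable_const]
      exact ENNReal.add_lt_top.2 ⟨by simp, key 2 le_rfl⟩

lemma ClassA.intensity_ne_top (hP : ClassA ν ℓ P) : intensity P ≠ ∞ := by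
  have := hP.lintegral_points_pow_lt_top 1
  simp only [pow_one] at this
  rw [intensity_eq]
  exact this.ne

/-! ### Almost every pattern is in general position -/

lemma measurable_contactDist : Measurable Config.contactDist := by
  refine measurable_of_Iio fun r => ?_
  have h : Config.contactDist ⁻¹' Set.Iio r = {φ | φ.count (Metric.eball 0 r) = 0}ᶜ := by
    ext φ
    simp only [Set.mem_preimage, Set.mem_Iio, contactDist, Metric.infEDist_lt_iff,
      Set.mem_compl_iff, Set.mem_ofPred_eq, count_eq_zero, not_forall, not_not, Metric.mem_eball,
      edist_comm, exists_prop]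
  rw [h]
  exact (measurable_count Metric.isOpen_eball.measurableSet (measurableSet_singleton 0)).compl

lemma ClassA.ae_nonempty (hP : ClassA ν ℓ P) : ∀ᵐ φ ∂P, φ.carrier.Nonempty := by
  have h1 := hP.contactDist_moments 1
  simp only [pow_one] at h1
  filter_upwards [ae_lt_top measurable_contactDist h1.ne] with φ hφ
  obtain ⟨x, hx, -⟩ := Metric.infEDist_lt_iff.1 hφ
  exact ⟨x, hx⟩

/-- By the Campbell–Mecke formula, a process of intensity zero has no points. -/
lemma ClassA.intensity_ne_zero (hP : ClassA ν ℓ P) : intensity P ≠ 0 := by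
  have := hP.isProbability
  intro h0
  have hc := lintegral_palmSum hP.stationary (f := fun _ _ => 1) measurable_const
  have : ∀ z, palmSum P z (fun _ => 1) = 0 := fun z => (palmSum_one P z).trans h0
  simp only [this, lintegral_zero, lintegral_const, one_mul] at hc
  have hm : Measurable fun φ : Config => φ.points Set.univ :=
    (Measure.measurable_coe .univ).comp measurable_points
  have hae := (lintegral_eq_zero_iff hm).1 hc.symm
  have hfalse : ∀ᵐ φ ∂P, False := by
    filter_upwards [hae, hP.ae_nonempty] with φ h ⟨x, hx⟩
    simp only [points_apply _ MeasurableSet.univ, Pi.zero_apply] at h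
    exact count_eq_zero.1 (ENat.toENNReal_eq_zero.1 h) x hx (Set.mem_univ x)
  exact (ae_neBot.2 (IsProbabilityMeasure.ne_zero P)).ne (eventually_false_iff_eq_bot.1 hfalse)

/-- A stationary process cannot have a finite positive number of points: otherwise the mean
number of points would be a finite translation-invariant measure on the plane. -/
lemma ClassA.ae_infinite (hP : ClassA ν ℓ P) : ∀ᵐ φ ∂P, φ.carrier.Infinite := by
  have := hP.isProbability
  have hm : Measurable fun φ : Config => φ.points Set.univ :=
    (Measure.measurable_coe .univ).comp measurable_points
  have hfin : ∀ n : ℕ, n ≠ 0 → ∀ᵐ φ ∂P, φ.points Set.univ ≠ (n : ℝ≥0∞) := by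
    intro n hn
    let E : Set Config := {φ | φ.points Set.univ = n}
    have hE : MeasurableSet E := hm (measurableSet_singleton _)
    have hEi : Measurable (E.indicator (1 : Config → ℝ≥0∞)) := measurable_one.indicator hE
    have hshift : ∀ (v : Plane) (φ : Config),
        E.indicator (1 : Config → ℝ≥0∞) (φ.shift v) = E.indicator 1 φ := by
      intro v φ
      have : (φ.shift v).points Set.univ = φ.points Set.univ := by
        rw [← lintegral_one, lintegral_points_shift, lintegral_one]
      simp [Set.indicator, E, this]
    have hc := lintegral_palmSum hP.stationary (f := fun _ => E.indicator 1)
      (hEi.comp measurable_snd)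
    have hconst : ∀ z, palmSum P z (E.indicator 1) = palmSum P 0 (E.indicator 1) := fun z => by
      simp only [palmSum, hshift]
    have hval : ∀ φ : Config, ∫⁻ _x, E.indicator 1 φ ∂φ.points = n * E.indicator 1 φ := by
      intro φ
      rw [lintegral_const, mul_comm]
      by_cases h : φ ∈ E
      · rw [show φ.points Set.univ = n from h]
      · simp [h]
    simp only [hconst, hval] at hc
    rw [lintegral_const, lintegral_const_mul _ hEi, lintegral_indicator_one hE,
      measure_univ_of_isAddLeftInvariant] at hc
    have h0 : palmSum P 0 (E.indicator 1) = 0 := by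
      by_contra hne
      rw [ENNReal.mul_top hne] at hc
      exact (ENNReal.mul_lt_top (ENNReal.natCast_lt_top n) (measure_lt_top P E)).ne hc.symm
    rw [h0, zero_mul] at hc
    have hE0 : P E = 0 := (mul_eq_zero.1 hc.symm).resolve_left (by exact_mod_cast hn)
    exact measure_eq_zero_iff_ae_notMem.1 hE0
  have hall : ∀ᵐ φ ∂P, ∀ n : ℕ, n ≠ 0 → φ.points Set.univ ≠ (n : ℝ≥0∞) :=
    ae_all_iff.2 fun n => by
      by_cases hn : n = 0
      · simp [hn]
      · simpa [hn] using hfin n hn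
  filter_upwards [hall, hP.ae_nonempty] with φ h ⟨x, hx⟩
  by_contra hf
  rw [← count_univ_eq_top] at hf
  obtain ⟨n, hn⟩ := ENat.ne_top_iff_exists.1 hf
  refine h n ?_ ?_
  · rintro rfl
    exact count_eq_zero.1 hn.symm x hx (Set.mem_univ x)
  · rw [points_apply _ .univ, ← hn]
    simp

lemma ClassA.ae_zero_notMem (hP : ClassA ν ℓ P) : ∀ᵐ φ ∂P, (0 : Plane) ∉ φ.carrier := by
  have := hP.isProbability
  have hm : Measurable fun z : Plane => ({0} : Set Plane).indicator (1 : Plane → ℝ≥0∞) z :=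
    measurable_one.indicator (measurableSet_singleton 0)
  have hc := lintegral_palmSum hP.stationary
    (f := fun z _ => ({0} : Set Plane).indicator 1 z) (hm.comp measurable_fst)
  have h0 : ∫⁻ z, palmSum P z (fun _ => ({0} : Set Plane).indicator 1 z) = 0 := by
    rw [lintegral_eq_zero_of_ae_eq_zero]
    have : ∀ᵐ z : Plane, z ≠ 0 := by simp [ae_iff]
    filter_upwards [this] with z hz
    simp [palmSum, hz]
  rw [h0] at hc
  simp only [lintegral_indicator_one (measurableSet_singleton (0 : Plane))] at hc
  have hm' : Measurable fun φ : Config => φ.points {0} :=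
    (Measure.measurable_coe (measurableSet_singleton 0)).comp measurable_points
  filter_upwards [(lintegral_eq_zero_iff hm').1 hc.symm] with φ h
  rw [← count_singleton_zero]
  rw [points_apply _ (measurableSet_singleton 0)] at h
  exact ENat.toENNReal_eq_zero.1 h

lemma volume_norm_eq_norm : volume {x : Fin 2 → Plane | ‖x 0‖ = ‖x 1‖} = 0 := by
  have hm : MeasurableSet {p : Plane × Plane | ‖p.1‖ = ‖p.2‖} :=
    measurableSet_eq_fun measurable_fst.norm measurable_snd.norm
  have h := (volume_preserving_finTwoArrow Plane).measure_preimage hm.nullMeasurableSet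
  have hs : (MeasurableEquiv.finTwoArrow ⁻¹' {p : Plane × Plane | ‖p.1‖ = ‖p.2‖})
      = {x : Fin 2 → Plane | ‖x 0‖ = ‖x 1‖} := by
    ext x
    simp [MeasurableEquiv.finTwoArrow]
  rw [hs] at h
  rw [h, Measure.volume_eq_prod, Measure.measure_prod_null hm]
  refine Eventually.of_forall fun x => ?_
  have : Prod.mk x ⁻¹' {p : Plane × Plane | ‖p.1‖ = ‖p.2‖} = {y | ‖y‖ ∈ ({‖x‖} : Set ℝ)} := by
    ext y
    simp [eq_comm]
  change volume (Prod.mk x ⁻¹' {p : Plane × Plane | ‖p.1‖ = ‖p.2‖}) = 0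
  rw [this]
  exact volume_norm_preimage_eq_zero (by simp)

/-- Two points of equal norm do not occur, since the second factorial moment measure is absolutely
continuous. -/
lemma ClassA.ae_injOn_norm (hP : ClassA ν ℓ P) :
    ∀ᵐ φ ∂P, Set.InjOn (fun x : Plane => ‖x‖) φ.carrier := by
  obtain ⟨ρ, hρ, -⟩ := hP.momentDensity_bounded 2 le_rfl
  have hm : MeasurableSet {x : Fin 2 → Plane | ‖x 0‖ = ‖x 1‖} :=
    measurableSet_eq_fun (measurable_pi_apply 0).norm (measurable_pi_apply 1).norm
  have h0 := hρ.2 _ hm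
  rw [setLIntegral_measure_zero _ _ volume_norm_eq_norm, factorialMoment] at h0
  rw [ae_iff]
  refine le_antisymm (b := (0 : ℝ≥0∞)) ?_ bot_le
  rw [← h0]
  have hms := measurableSet_injOn_norm.compl
  -- The number of pairs need not be known to be measurable: it dominates a measurable indicator.
  rw [← lintegral_indicator_one (by exact hms)]
  refine lintegral_mono fun φ => ?_
  by_cases hφ : Set.InjOn (fun x : Plane => ‖x‖) φ.carrier
  · rw [Set.indicator_of_notMem (by simpa using hφ)]
    exact bot_le
  rw [Set.indicator_of_mem (by exact hφ)]
  simp only [Set.InjOn, not_forall] at hφ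
  obtain ⟨x, hx, y, hy, hxy, hne⟩ := hφ
  have hmem : ![x, y] ∈ ({x | Function.Injective x ∧ (∀ i, x i ∈ φ.carrier) ∧
      x ∈ {x : Fin 2 → Plane | ‖x 0‖ = ‖x 1‖}} : Set (Fin 2 → Plane)) := by
    refine ⟨?_, ?_, hxy⟩
    · intro i j hij
      fin_cases i <;> fin_cases j <;> simp_all
    · intro i
      fin_cases i <;> simp [hx, hy]
  have := Set.one_le_encard_iff_nonempty.2 ⟨_, hmem⟩
  calc (1 : ℝ≥0∞) = ((1 : ℕ∞) : ℝ≥0∞) := by simp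
    _ ≤ _ := ENat.toENNReal_le.2 this

lemma ClassA.ae_isGeneral (hP : ClassA ν ℓ P) : ∀ᵐ φ ∂P, φ.IsGeneral := by
  filter_upwards [hP.ae_infinite, hP.ae_zero_notMem, hP.ae_injOn_norm] with φ h₁ h₂ h₃
  exact ⟨h₁, h₂, h₃⟩

/-- Under the Palm distributions, too, almost every pattern is in general position. -/
lemma ClassA.ae_palmSum_not_isGeneral (hP : ClassA ν ℓ P) :
    ∀ᵐ z, palmSum P z ({φ : Config | φ.IsGeneral}ᶜ.indicator 1) = 0 := by
  have := hP.isProbability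
  have hm : Measurable ({φ : Config | φ.IsGeneral}ᶜ.indicator (1 : Config → ℝ≥0∞)) :=
    measurable_one.indicator measurableSet_isGeneral.compl
  have hc := lintegral_palmSum hP.stationary
    (f := fun _ => {φ : Config | φ.IsGeneral}ᶜ.indicator 1) (hm.comp measurable_snd)
  have h0 : ∫⁻ φ, ∫⁻ _x, {φ : Config | φ.IsGeneral}ᶜ.indicator 1 φ ∂φ.points ∂P = 0 := by
    refine lintegral_eq_zero_of_ae_eq_zero ?_
    filter_upwards [hP.ae_isGeneral] with φ hφ
    simp [hφ]
  rw [h0] at hc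
  exact (lintegral_eq_zero_iff
    (measurable_palmSum P (f := fun _ => {φ : Config | φ.IsGeneral}ᶜ.indicator 1)
      measurable_id (hm.comp measurable_snd))).1 hc

end ClassA

/-! ### Moments of sums over the process -/

/-- Jensen's inequality for the measure with density `g`, not normalized. -/
lemma lintegral_mul_pow_succ_le {α : Type*} [MeasurableSpace α] {μ : Measure α}
    {g f : α → ℝ≥0∞} (hg : Measurable g) (hf : Measurable f) (k : ℕ) :
    (∫⁻ x, g x * f x ∂μ) ^ (k + 1) ≤ (∫⁻ x, g x ∂μ) ^ k * ∫⁻ x, g x * f x ^ (k + 1) ∂μ := by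
  have hk : (0 : ℝ) < k + 1 := by positivity
  have h := ENNReal.lintegral_mul_norm_pow_le (μ := μ) (f := g)
    (g := fun x => g x * f x ^ (k + 1)) hg.aemeasurable
    (hg.mul (hf.pow_const _)).aemeasurable (p := k / (k + 1)) (q := 1 / (k + 1))
    (by positivity) (by positivity) (by field_simp)
  have hpt : ∀ x, g x ^ ((k : ℝ) / (k + 1)) * (g x * f x ^ (k + 1)) ^ ((1 : ℝ) / (k + 1))
      = g x * f x := by
    intro x
    rw [ENNReal.mul_rpow_of_nonneg _ _ (by positivity), ← mul_assoc,
      ← ENNReal.rpow_add_of_nonneg _ _ (by positivity) (by positivity), ← ENNReal.rpow_natCast,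
      ← ENNReal.rpow_mul]
    push_cast
    rw [mul_one_div_cancel hk.ne', ← add_div, div_self hk.ne', ENNReal.rpow_one, ENNReal.rpow_one]
  simp_rw [hpt] at h
  refine (pow_le_pow_left' h (k + 1)).trans_eq ?_
  rw [mul_pow, ← ENNReal.rpow_natCast, ← ENNReal.rpow_natCast, ← ENNReal.rpow_mul,
    ← ENNReal.rpow_mul]
  push_cast
  rw [one_div_mul_cancel hk.ne', div_mul_cancel₀ _ hk.ne', ENNReal.rpow_one, ENNReal.rpow_natCast]

/-- The function `(1 + ‖x‖)^(-α)`: bounded, integrable for `α > 2`, and comparable with both path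
losses away from the origin. -/
def decay (α : ℝ) (x : Plane) : ℝ≥0∞ := ENNReal.ofReal ((1 + ‖x‖) ^ (-α))

lemma measurable_decay (α : ℝ) : Measurable (decay α) :=
  ENNReal.measurable_ofReal.comp (by fun_prop)

lemma lintegral_decay_lt_top {α : ℝ} (hα : 2 < α) : ∫⁻ x, decay α x < ∞ :=
  finite_integral_one_add_norm (by simpa using hα)

lemma decay_le {α : ℝ} (hα : 0 < α) {x v : Plane} (h : x - v ∈ unitSquare) :
    decay α x ≤ ENNReal.ofReal (3 ^ α) * decay α v := by
  rw [decay, decay, ← ENNReal.ofReal_mul (by positivity)]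
  refine ENNReal.ofReal_le_ofReal ?_
  have h1 : 1 + ‖v‖ ≤ 3 * (1 + ‖x‖) := by
    have h2 : ‖v‖ ≤ ‖x‖ + ‖x - v‖ := by
      have := norm_sub_le x (x - v)
      simpa using this
    linarith [norm_le_of_mem_unitSquare h, norm_nonneg x]
  have h3 : (1 + ‖v‖) ^ α ≤ 3 ^ α * (1 + ‖x‖) ^ α := by
    rw [← Real.mul_rpow (by norm_num) (by positivity)]
    exact Real.rpow_le_rpow (by positivity) h1 hα.le
  rw [Real.rpow_neg (by positivity), Real.rpow_neg (by positivity), ← div_eq_mul_inv,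
    inv_eq_one_div, div_le_div_iff₀ (by positivity) (by positivity), one_mul]
  exact h3

section ClassA

variable {ν : Measure ℝ} {ℓ : Plane → ℝ≥0∞} {P : Measure Config}

/-- The sum of the decay function over the process has moments of all orders: dominate it by an
average of the numbers of points in translated unit squares, and use stationarity. -/
lemma ClassA.lintegral_decay_pow_lt_top (hP : ClassA ν ℓ P) {α : ℝ} (hα : 2 < α) (k : ℕ) :
    ∫⁻ φ, (∫⁻ x, decay α x ∂φ.points) ^ (k + 1) ∂P < ∞ := by
  have := hP.isProbability
  have hU := measurableSet_unitSquare
  let C := ENNReal.ofReal (3 ^ α)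
  let N : Plane → Config → ℝ≥0∞ := fun v φ => ∫⁻ x, unitSquare.indicator 1 (x - v) ∂φ.points
  have hU1 : Measurable (unitSquare.indicator (1 : Plane → ℝ≥0∞)) := measurable_one.indicator hU
  have hN : Measurable fun p : Plane × Config => N p.1 p.2 :=
    measurable_lintegral_points (g := fun (p : Plane × Config) x =>
      unitSquare.indicator (1 : Plane → ℝ≥0∞) (x - p.1)) measurable_snd
      (hU1.comp (measurable_snd.sub (measurable_fst.comp measurable_fst)))
  have hNv : ∀ v, ∫⁻ φ, N v φ ^ (k + 1) ∂P = ∫⁻ φ, φ.points unitSquare ^ (k + 1) ∂P := by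
    intro v
    have hm : Measurable fun φ : Config => φ.points unitSquare ^ (k + 1) :=
      ((Measure.measurable_coe hU).comp measurable_points).pow_const _
    rw [← hP.stationary.lintegral_shift (-v) hm]
    refine lintegral_congr fun φ => ?_
    rw [← lintegral_indicator_one hU, lintegral_points_shift]
    simp [N, sub_eq_add_neg]
  have hdecay : ∀ x, decay α x ≤
      ∫⁻ v, C * (decay α v * unitSquare.indicator 1 (x - v)) := by
    intro x
    calc decay α x = ∫⁻ v, decay α x * unitSquare.indicator 1 (x - v) := by
          have hmx : Measurable fun v => unitSquare.indicator (1 : Plane → ℝ≥0∞) (x - v) :=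
            hU1.comp (measurable_const.sub measurable_id)
          rw [lintegral_const_mul _ hmx,
            lintegral_sub_left_eq_self (unitSquare.indicator (1 : Plane → ℝ≥0∞)) x,
            lintegral_indicator_one hU, volume_unitSquare, mul_one]
      _ ≤ _ := by
          refine lintegral_mono fun v => ?_
          by_cases h : x - v ∈ unitSquare
          · simpa [h] using decay_le (by linarith) h
          · simp [h]
  have hsum : ∀ φ : Config, ∫⁻ x, decay α x ∂φ.points ≤ C * ∫⁻ v, decay α v * N v φ := by
    intro φ
    have hjoint : Measurable fun p : Plane × Plane =>
        C * (decay α p.2 * unitSquare.indicator (1 : Plane → ℝ≥0∞) (p.1 - p.2)) :=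
      (((measurable_decay α).comp measurable_snd).mul
        (hU1.comp (measurable_fst.sub measurable_snd))).const_mul C
    have hswap := lintegral_lintegral_swap (μ := φ.points) (ν := volume)
      (f := fun x v => C * (decay α v * unitSquare.indicator 1 (x - v))) hjoint.aemeasurable
    refine (lintegral_mono hdecay).trans_eq ?_
    rw [hswap, ← lintegral_const_mul' _ _ ENNReal.ofReal_ne_top]
    refine lintegral_congr fun v => ?_
    have hmv : Measurable fun x : Plane => unitSquare.indicator (1 : Plane → ℝ≥0∞) (x - v) :=
      hU1.comp (measurable_id.sub measurable_const)
    rw [lintegral_const_mul _ (hmv.const_mul _), lintegral_const_mul _ hmv]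
  have hmN : Measurable fun p : Plane × Config => decay α p.1 * N p.1 p.2 ^ (k + 1) :=
    ((measurable_decay α).comp measurable_fst).mul (hN.pow_const _)
  calc ∫⁻ φ, (∫⁻ x, decay α x ∂φ.points) ^ (k + 1) ∂P
      ≤ ∫⁻ φ, C ^ (k + 1) * (∫⁻ v, decay α v) ^ k *
          (∫⁻ v, decay α v * N v φ ^ (k + 1)) ∂P := by
        refine lintegral_mono fun φ => ?_
        refine (pow_le_pow_left' (hsum φ) (k + 1)).trans ?_
        rw [mul_pow, mul_assoc]
        gcongr
        exact lintegral_mul_pow_succ_le (measurable_decay α) (hN.comp measurable_prodMk_right) k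
    _ = C ^ (k + 1) * (∫⁻ v, decay α v) ^ k *
          (∫⁻ v, decay α v * ∫⁻ φ, φ.points unitSquare ^ (k + 1) ∂P) := by
        rw [lintegral_const_mul' _ _ (ENNReal.mul_ne_top
          (ENNReal.pow_ne_top ENNReal.ofReal_ne_top)
          (ENNReal.pow_ne_top (lintegral_decay_lt_top hα).ne)),
          ← lintegral_lintegral_swap hmN.aemeasurable]
        congr 1
        refine lintegral_congr fun v => ?_
        have hNvm : Measurable fun φ => N v φ ^ (k + 1) :=
          (hN.comp measurable_prodMk_left).pow_const _
        rw [lintegral_const_mul _ hNvm, hNv]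
    _ < ∞ := by
        rw [lintegral_mul_const _ (measurable_decay α)]
        have h1 := lintegral_decay_lt_top hα
        have h2 := hP.lintegral_points_pow_lt_top (k + 1)
        exact ENNReal.mul_lt_top (ENNReal.mul_lt_top (ENNReal.pow_lt_top ENNReal.ofReal_lt_top)
          (ENNReal.pow_lt_top h1)) (ENNReal.mul_lt_top h1 h2)

end ClassA

/-- Given the weights, the moments of a sum of weighted i.i.d. variables are bounded by the powers
of the total weight. -/
lemma lintegral_tsum_mark_pow_le (ν : Measure ℝ) [IsProbabilityMeasure ν] (w : ℕ → ℝ≥0∞)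
    (k : ℕ) :
    ∫⁻ h, (∑' n, ENNReal.ofReal (h n) * w n) ^ (k + 1) ∂markLaw ν
      ≤ (∑' n, w n) ^ (k + 1) * ∫⁻ t, ENNReal.ofReal t ^ (k + 1) ∂ν := by
  have hm : ∀ n, Measurable fun h : ℕ → ℝ => ENNReal.ofReal (h n) ^ (k + 1) := fun n =>
    (ENNReal.measurable_ofReal.comp (measurable_pi_apply n)).pow_const _
  have hev : ∀ n, ∫⁻ h, ENNReal.ofReal (h n) ^ (k + 1) ∂markLaw ν
      = ∫⁻ t, ENNReal.ofReal t ^ (k + 1) ∂ν := fun n =>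
    (measurePreserving_eval_infinitePi (fun _ : ℕ => ν) n).lintegral_comp
      (ENNReal.measurable_ofReal.pow_const (k + 1))
  calc ∫⁻ h, (∑' n, ENNReal.ofReal (h n) * w n) ^ (k + 1) ∂markLaw ν
      ≤ ∫⁻ h, (∑' n, w n) ^ k * ∑' n, w n * ENNReal.ofReal (h n) ^ (k + 1) ∂markLaw ν := by
        refine lintegral_mono fun h => ?_
        have := lintegral_mul_pow_succ_le (μ := Measure.count) (g := w)
          (f := fun n => ENNReal.ofReal (h n)) Measurable.of_discrete Measurable.of_discrete k
        simpa only [lintegral_count, mul_comm (w _)] using this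
    _ = (∑' n, w n) ^ k * ∑' n, w n * ∫⁻ t, ENNReal.ofReal t ^ (k + 1) ∂ν := by
        rw [lintegral_const_mul _ (Measurable.tsum fun n => (hm n).const_mul _),
          lintegral_tsum fun n => ((hm n).const_mul _).aemeasurable]
        simp_rw [fun n => lintegral_const_mul (μ := markLaw ν) (w n) (hm n), hev]
    _ = _ := by rw [ENNReal.tsum_mul_right, ← mul_assoc, pow_succ]

/-! ### Comparison of the path losses with the decay function -/

lemma one_add_rpow_le {α r : ℝ} (hα : 0 < α) (hr : 0 ≤ r) :
    (1 + r) ^ α ≤ 2 ^ α * max 1 (r ^ α) := by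
  have h : (1 + r) ^ α ≤ (2 * max 1 r) ^ α :=
    Real.rpow_le_rpow (by positivity)
      (by rcases le_total 1 r with h | h <;> simp [h] <;> linarith) hα.le
  rw [Real.mul_rpow (by norm_num) (by positivity)] at h
  refine h.trans ?_
  gcongr
  rcases le_total 1 r with h | h <;> simp [h]

section PathLoss

variable {α : ℝ} {ℓ : Plane → ℝ≥0∞}

lemma measurable_pathLoss (hℓ : ℓ = nonsingularPathLoss α ∨ ℓ = singularPathLoss α) :
    Measurable ℓ := by
  rcases hℓ with rfl | rfl
  · exact ((measurable_enorm.pow_const α).const_add 1).inv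
  · exact measurable_enorm.pow_const (-α)

lemma enorm_rpow (hα : 0 < α) (x : Plane) : ‖x‖ₑ ^ α = ENNReal.ofReal (‖x‖ ^ α) := by
  rw [← ofReal_norm, ENNReal.ofReal_rpow_of_nonneg (norm_nonneg x) hα.le]

lemma nonsingularPathLoss_eq (hα : 0 < α) (x : Plane) :
    nonsingularPathLoss α x = ENNReal.ofReal ((1 + ‖x‖ ^ α)⁻¹) := by
  have h : 0 ≤ ‖x‖ ^ α := by positivity
  rw [nonsingularPathLoss, enorm_rpow hα, ENNReal.ofReal_inv_of_pos (by positivity),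
    ENNReal.ofReal_add zero_le_one h, ENNReal.ofReal_one]

lemma singularPathLoss_eq (hα : 0 < α) {x : Plane} (hx : x ≠ 0) :
    singularPathLoss α x = ENNReal.ofReal ((‖x‖ ^ α)⁻¹) := by
  have h : 0 < ‖x‖ := norm_pos_iff.2 hx
  rw [singularPathLoss, ENNReal.rpow_neg, enorm_rpow hα, ENNReal.ofReal_inv_of_pos (by positivity)]

lemma pathLoss_ne_zero (hα : 0 < α) (hℓ : ℓ = nonsingularPathLoss α ∨ ℓ = singularPathLoss α)
    {x : Plane} (hx : x ≠ 0) : ℓ x ≠ 0 := by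
  have h : 0 < ‖x‖ := norm_pos_iff.2 hx
  rcases hℓ with rfl | rfl
  · rw [nonsingularPathLoss_eq hα]
    exact (ENNReal.ofReal_pos.2 (by positivity)).ne'
  · rw [singularPathLoss_eq hα hx]
    exact (ENNReal.ofReal_pos.2 (by positivity)).ne'

lemma pathLoss_ne_top (hα : 0 < α) (hℓ : ℓ = nonsingularPathLoss α ∨ ℓ = singularPathLoss α)
    {x : Plane} (hx : x ≠ 0) : ℓ x ≠ ∞ := by
  rcases hℓ with rfl | rfl
  · rw [nonsingularPathLoss_eq hα]
    exact ENNReal.ofReal_ne_top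
  · rw [singularPathLoss_eq hα hx]
    exact ENNReal.ofReal_ne_top

lemma inv_pathLoss_le (hℓ : ℓ = nonsingularPathLoss α ∨ ℓ = singularPathLoss α) (x : Plane) :
    (ℓ x)⁻¹ ≤ 1 + ‖x‖ₑ ^ α := by
  rcases hℓ with rfl | rfl
  · rw [nonsingularPathLoss, inv_inv]
  · rw [singularPathLoss, ENNReal.rpow_neg, inv_inv]
    exact le_add_self

/-- The factor `1 + ‖u‖^α` absorbs both the growth of `1 / ℓ(u)` and, since `x` is farther from
the origin than `u`, the singularity of `ℓ(x)`. -/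
lemma pathLoss_div_le (hα : 0 < α) (hℓ : ℓ = nonsingularPathLoss α ∨ ℓ = singularPathLoss α)
    {u x : Plane} (hu : u ≠ 0) (hux : ‖u‖ ≤ ‖x‖) :
    ℓ x / ℓ u ≤ (1 + ‖u‖ₑ ^ α) * (ENNReal.ofReal (2 ^ α) * decay α x) := by
  have hu0 : 0 < ‖u‖ := norm_pos_iff.2 hu
  have hx0 : 0 < ‖x‖ := hu0.trans_le hux
  have hx : x ≠ 0 := norm_pos_iff.1 hx0
  have hb := one_add_rpow_le hα hx0.le
  have hxa : 0 < ‖x‖ ^ α := by positivity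
  have hua : 0 < ‖u‖ ^ α := by positivity
  have h1x : 0 < (1 + ‖x‖) ^ α := by positivity
  have hmono : ‖u‖ ^ α ≤ ‖x‖ ^ α := Real.rpow_le_rpow hu0.le hux hα.le
  have h1u : 1 + ‖u‖ₑ ^ α = ENNReal.ofReal (1 + ‖u‖ ^ α) := by
    rw [enorm_rpow hα, ENNReal.ofReal_add zero_le_one hua.le, ENNReal.ofReal_one]
  have h2 : (0 : ℝ) < 2 ^ α := by positivity
  rw [h1u, decay, ← ENNReal.ofReal_mul (by positivity), ← ENNReal.ofReal_mul (by positivity),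
    Real.rpow_neg (by positivity)]
  rcases hℓ with rfl | rfl
  · rw [nonsingularPathLoss_eq hα, nonsingularPathLoss_eq hα,
      ← ENNReal.ofReal_div_of_pos (by positivity)]
    refine ENNReal.ofReal_le_ofReal ?_
    rw [div_inv_eq_mul, mul_comm]
    gcongr
    rw [← div_eq_mul_inv, inv_eq_one_div, div_le_div_iff₀ (by positivity) h1x, one_mul]
    refine hb.trans ?_
    gcongr
    exact max_le (by linarith) (by linarith)
  · rw [singularPathLoss_eq hα hx, singularPathLoss_eq hα hu,
      ← ENNReal.ofReal_div_of_pos (by positivity)]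
    refine ENNReal.ofReal_le_ofReal ?_
    rw [div_inv_eq_mul, ← div_eq_inv_mul, ← div_eq_mul_inv, ← mul_div_assoc,
      div_le_div_iff₀ hxa h1x]
    rcases le_total (‖x‖ ^ α) 1 with h | h
    · rw [max_eq_left h, mul_one] at hb
      calc ‖u‖ ^ α * (1 + ‖x‖) ^ α ≤ ‖x‖ ^ α * 2 ^ α := by gcongr
        _ ≤ (1 + ‖u‖ ^ α) * 2 ^ α * ‖x‖ ^ α := by nlinarith [mul_pos (mul_pos hua h2) hxa]
    · rw [max_eq_right h] at hb
      calc ‖u‖ ^ α * (1 + ‖x‖) ^ α ≤ ‖u‖ ^ α * (2 ^ α * ‖x‖ ^ α) := by gcongr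
        _ ≤ (1 + ‖u‖ ^ α) * 2 ^ α * ‖x‖ ^ α := by nlinarith [mul_pos h2 hxa]

end PathLoss

/-! ### The ratio of interference and noise to the mean received signal -/

/-- The total interference and noise, divided by the path loss of the nearest point, when the `n`th
nearest of the other points has fading `h n`. -/
def interferenceRatio (ℓ : Plane → ℝ≥0∞) (W : ℝ≥0) (φ : Config) (h : ℕ → ℝ) : ℝ≥0∞ :=
  (rankedInterference ℓ φ h + W) / ranked ℓ 0 φ

lemma measurable_interferenceRatio {ℓ : Plane → ℝ≥0∞} (hℓ : Measurable ℓ) (W : ℝ≥0) :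
    Measurable fun p : Config × (ℕ → ℝ) => interferenceRatio ℓ W p.1 p.2 :=
  ((measurable_rankedInterference hℓ).add measurable_const).div
    ((measurable_ranked hℓ 0).comp measurable_fst)

lemma interferenceRatio_le {α : ℝ} (hα : 0 < α) {ℓ : Plane → ℝ≥0∞}
    (hℓ : ℓ = nonsingularPathLoss α ∨ ℓ = singularPathLoss α) (W : ℝ≥0) {φ : Config}
    (hφ : φ.IsGeneral) (h : ℕ → ℝ) :
    interferenceRatio ℓ W φ h ≤ (1 + φ.contactDist ^ α) *
      (ENNReal.ofReal (2 ^ α) * rankedInterference (decay α) φ h + W) := by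
  obtain ⟨e, he⟩ := hφ.exists_equiv
  have hu : (e 0 : Plane) ≠ 0 := fun h0 => hφ.zero_notMem (h0 ▸ (e 0).2)
  rw [contactDist_eq he, interferenceRatio, ENNReal.add_div, mul_add, ranked_eq he]
  refine add_le_add ?_ ?_
  · rw [rankedInterference, rankedInterference, div_eq_mul_inv, ← ENNReal.tsum_mul_right,
      ← ENNReal.tsum_mul_left, ← ENNReal.tsum_mul_left]
    refine ENNReal.tsum_le_tsum fun n => ?_
    rw [ranked_eq he, ranked_eq he, mul_assoc, ← div_eq_mul_inv]
    calc ENNReal.ofReal (h n) * (ℓ (e (n + 1)) / ℓ (e 0))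
        ≤ ENNReal.ofReal (h n) * ((1 + ‖(e 0 : Plane)‖ₑ ^ α) *
            (ENNReal.ofReal (2 ^ α) * decay α (e (n + 1)))) := by
          gcongr
          exact pathLoss_div_le hα hℓ hu (norm_le_of_enumeration he (e (n + 1)).2)
      _ = _ := by ring
  · rw [div_eq_mul_inv, mul_comm]
    gcongr
    exact inv_pathLoss_le hℓ _

lemma add_pow_le_two_pow_mul (a b : ℝ≥0∞) (n : ℕ) : (a + b) ^ n ≤ 2 ^ n * (a ^ n + b ^ n) := by
  rcases le_total a b with h | h
  · calc (a + b) ^ n ≤ (2 * b) ^ n := by rw [two_mul]; gcongr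
      _ ≤ _ := by rw [mul_pow]; gcongr; exact le_add_self
  · calc (a + b) ^ n ≤ (2 * a) ^ n := by rw [two_mul]; gcongr
      _ ≤ _ := by rw [mul_pow]; gcongr; exact le_self_add

lemma rpow_le_one_add_pow {m : ℝ} (hm : 0 ≤ m) {n : ℕ} (hmn : m ≤ n) (x : ℝ≥0∞) :
    x ^ m ≤ 1 + x ^ n := by
  rcases le_total x 1 with h | h
  · exact (ENNReal.rpow_le_one h hm).trans le_self_add
  · rw [← ENNReal.rpow_natCast]
    exact (ENNReal.rpow_le_rpow_of_exponent_le h hmn).trans le_add_self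

/-- The ratio of interference and noise to the mean signal has moments of all positive orders. -/
theorem ClassA.lintegral_interferenceRatio_rpow_lt_top {α : ℝ} (hα : 2 < α)
    {ℓ : Plane → ℝ≥0∞} (hℓ : ℓ = nonsingularPathLoss α ∨ ℓ = singularPathLoss α) (W : ℝ≥0)
    {ν : Measure ℝ} [IsProbabilityMeasure ν] (hmom : ∀ n : ℕ, Integrable (fun t : ℝ => t ^ n) ν)
    {P : Measure Config} (hP : ClassA ν ℓ P) {m : ℝ} (hm : 0 < m) :
    ∫⁻ φ, ∫⁻ h, interferenceRatio ℓ W φ h ^ m ∂markLaw ν ∂P < ∞ := by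
  have := hP.isProbability
  have hα0 : 0 < α := by linarith
  obtain ⟨p, hp⟩ := exists_nat_ge m
  have hp0 : p ≠ 0 := by
    rintro rfl
    norm_num at hp
    linarith
  -- `(A B)^p ≤ A^(2p) + B^(2p)` separates the contact distance from the sum over the process.
  obtain ⟨k, hk⟩ : ∃ k, p * 2 = k + 1 := ⟨p * 2 - 1, by omega⟩
  obtain ⟨N, hN⟩ := exists_nat_ge (α * (k + 1 : ℕ))
  let C : ℝ≥0∞ := ENNReal.ofReal (2 ^ α)
  let M : ℝ≥0∞ := ∫⁻ t, ENNReal.ofReal t ^ (k + 1) ∂ν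
  have hM : M ≠ ∞ := by
    refine (lt_of_le_of_lt (lintegral_mono fun t => ?_) (hmom (k + 1)).2).ne
    rw [enorm_pow]
    gcongr
    exact Real.ofReal_le_enorm t
  let S : Config → ℝ≥0∞ := fun φ => ∫⁻ x, decay α x ∂φ.points
  have hS : Measurable S := Measure.measurable_lintegral (measurable_decay α) |>.comp
    measurable_points
  have hpt : ∀ φ : Config, φ.IsGeneral → ∀ h, interferenceRatio ℓ W φ h ^ m
      ≤ 1 + (2 ^ (k + 1) * (1 + (1 + φ.contactDist ^ N)) + 2 ^ (k + 1) *
        (C ^ (k + 1) * rankedInterference (decay α) φ h ^ (k + 1) + (W : ℝ≥0∞) ^ (k + 1))) := by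
    intro φ hφ h
    refine (rpow_le_one_add_pow hm.le hp _).trans ?_
    gcongr
    refine (pow_le_pow_left' (interferenceRatio_le hα0 hℓ W hφ h) p).trans ?_
    have hAB : ∀ a b : ℝ≥0∞, (a * b) ^ p ≤ a ^ (k + 1) + b ^ (k + 1) := by
      intro a b
      rw [← hk, mul_comm p 2, pow_mul, pow_mul]
      rcases le_total a b with hab | hab
      · exact (pow_le_pow_left' ((mul_le_mul_left hab b).trans_eq (sq b).symm) p).trans le_add_self
      · exact (pow_le_pow_left' ((mul_le_mul_right hab a).trans_eq (sq a).symm) p).trans le_self_add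
    refine (hAB _ _).trans ?_
    refine add_le_add ?_ ?_
    · refine (add_pow_le_two_pow_mul _ _ _).trans ?_
      rw [one_pow, ← ENNReal.rpow_mul_natCast]
      gcongr
      exact rpow_le_one_add_pow (by positivity) hN _
    · refine (add_pow_le_two_pow_mul _ _ _).trans ?_
      rw [mul_pow]
  have hmark : ∀ φ : Config, φ.IsGeneral →
      ∫⁻ h, rankedInterference (decay α) φ h ^ (k + 1) ∂markLaw ν ≤ S φ ^ (k + 1) * M := by
    intro φ hφ
    obtain ⟨e, he⟩ := hφ.exists_equiv
    refine (lintegral_tsum_mark_pow_le ν _ k).trans ?_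
    gcongr
    simp only [S, lintegral_points, ranked_eq he]
    exact ENNReal.tsum_comp_le_tsum_of_injective
      (e.injective.comp (add_left_injective 1)) fun x : φ.carrier => decay α x
  have hbound : ∀ φ : Config, φ.IsGeneral → ∫⁻ h, interferenceRatio ℓ W φ h ^ m ∂markLaw ν
      ≤ 1 + (2 ^ (k + 1) * (1 + (1 + φ.contactDist ^ N)) + 2 ^ (k + 1) *
        (C ^ (k + 1) * (S φ ^ (k + 1) * M) + (W : ℝ≥0∞) ^ (k + 1))) := by
    intro φ hφ
    have hJ : Measurable fun h => rankedInterference (decay α) φ h ^ (k + 1) :=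
      (measurable_rankedInterference_right _ φ).pow_const _
    refine (lintegral_mono (hpt φ hφ)).trans ?_
    rw [lintegral_add_left measurable_const, lintegral_add_left measurable_const,
      lintegral_const_mul _ ((hJ.const_mul _).add_const _), lintegral_add_right _ measurable_const,
      lintegral_const_mul _ hJ]
    simp only [lintegral_const, measure_univ, mul_one]
    gcongr
    exact hmark φ hφ
  have hcd : Measurable fun φ : Config => φ.contactDist ^ N := measurable_contactDist.pow_const N
  have hSk : Measurable fun φ : Config => S φ ^ (k + 1) := hS.pow_const _
  have h2 : (2 : ℝ≥0∞) ^ (k + 1) < ∞ := ENNReal.pow_lt_top (by simp)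
  refine lt_of_le_of_lt (lintegral_mono_ae (hP.ae_isGeneral.mono hbound)) ?_
  rw [lintegral_add_left measurable_const,
    lintegral_add_left (((hcd.const_add 1).const_add 1).const_mul _),
    lintegral_const_mul _ ((hcd.const_add 1).const_add 1),
    lintegral_const_mul _ (((hSk.mul_const M).const_mul _).add_const _),
    lintegral_add_left measurable_const, lintegral_add_left measurable_const,
    lintegral_add_right _ measurable_const, lintegral_const_mul _ (hSk.mul_const M),
    lintegral_mul_const _ hSk]
  simp only [lintegral_const, measure_univ, mul_one]
  have hS' := hP.lintegral_decay_pow_lt_top hα k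
  have hξ := hP.contactDist_moments N
  refine ENNReal.add_lt_top.2 ⟨by simp, ENNReal.add_lt_top.2 ⟨ENNReal.mul_lt_top h2 ?_,
    ENNReal.mul_lt_top h2 (ENNReal.add_lt_top.2 ⟨?_, ENNReal.pow_lt_top (by simp)⟩)⟩⟩
  · exact ENNReal.add_lt_top.2 ⟨by simp, ENNReal.add_lt_top.2 ⟨by simp, hξ⟩⟩
  · exact ENNReal.mul_lt_top (ENNReal.pow_lt_top (by simp [C]))
      (ENNReal.mul_lt_top hS' hM.lt_top)

/-! ### The density of the contact distance -/

section ContactDistance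

variable {ν : Measure ℝ} {ℓ : Plane → ℝ≥0∞} {P : Measure Config}

lemma contactDist_toReal_eq {φ : Config} {e : ℕ ≃ φ.carrier}
    (he : ∀ n, φ.count (Metric.ball 0 ‖(e n : Plane)‖) = n) :
    φ.contactDist.toReal = ‖(e 0 : Plane)‖ := by
  rw [contactDist_eq he, toReal_enorm]

/-- By the Campbell–Mecke formula, the contact distance avoids a set of radii if the corresponding
set of points of the plane is Lebesgue-null. -/
lemma ClassA.measure_contactDist_mem_eq_zero (hP : ClassA ν ℓ P) {N : Set ℝ}
    (hN : MeasurableSet N) (h : volume {z : Plane | ‖z‖ ∈ N} = 0) :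
    P {φ | φ.contactDist.toReal ∈ N} = 0 := by
  have := hP.isProbability
  let T : Set Plane := {z | ‖z‖ ∈ N}
  have hT : MeasurableSet T := measurable_norm hN
  have hTi : Measurable (T.indicator (1 : Plane → ℝ≥0∞)) := measurable_one.indicator hT
  have hc := lintegral_palmSum hP.stationary (f := fun z _ => T.indicator 1 z)
    (hTi.comp measurable_fst)
  have h0 : ∫⁻ z, palmSum P z (fun _ => T.indicator 1 z) = 0 := by
    rw [lintegral_eq_zero_of_ae_eq_zero]
    filter_upwards [measure_eq_zero_iff_ae_notMem.1 h] with z hz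
    have hz' : z ∉ T := hz
    simp [palmSum, hz']
  rw [h0] at hc
  have hm : MeasurableSet {φ : Config | φ.contactDist.toReal ∈ N} :=
    measurable_contactDist.ennreal_toReal hN
  rw [← lintegral_indicator_one hm]
  refine le_antisymm (b := (0 : ℝ≥0∞)) (hc ▸ lintegral_mono_ae ?_) bot_le
  filter_upwards [hP.ae_isGeneral] with φ hφ
  obtain ⟨e, he⟩ := hφ.exists_equiv
  by_cases hmem : φ.contactDist.toReal ∈ N
  · rw [Set.indicator_of_mem (by exact hmem), lintegral_points]
    rw [contactDist_toReal_eq he] at hmem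
    refine le_trans ?_ (ENNReal.le_tsum (e 0))
    rw [Set.indicator_of_mem (show (e 0 : Plane) ∈ T from hmem)]
    rfl
  · rw [Set.indicator_of_notMem (by exact hmem)]
    exact bot_le

lemma ClassA.hasPDF_contactDist (hP : ClassA ν ℓ P) :
    HasPDF (fun φ : Config => φ.contactDist.toReal) P volume := by
  have := hP.isProbability
  rw [Real.hasPDF_iff_of_aemeasurable measurable_contactDist.ennreal_toReal.aemeasurable]
  refine Measure.AbsolutelyContinuous.mk fun N hN h => ?_
  rw [Measure.map_apply measurable_contactDist.ennreal_toReal hN]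
  exact hP.measure_contactDist_mem_eq_zero hN (volume_norm_preimage_eq_zero h)

end ContactDistance

/-! ### Rotation invariance of the conditional expectations -/

section Rotation

variable {ν : Measure ℝ} {ℓ : Plane → ℝ≥0∞} {P : Measure Config}

lemma indicator_apply_congr {β γ : Type*} {A : Set β} {B : Set γ} {f : β → ℝ≥0∞} {g : γ → ℝ≥0∞}
    {x : β} {y : γ} (h : x ∈ A ↔ y ∈ B) (hfg : f x = g y) : A.indicator f x = B.indicator g y := by
  by_cases hx : x ∈ A
  · rw [Set.indicator_of_mem hx, Set.indicator_of_mem (h.1 hx), hfg]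
  · rw [Set.indicator_of_notMem hx, Set.indicator_of_notMem (mt h.2 hx)]

lemma count_ball_move (U : Plane ≃ₗᵢ[ℝ] Plane) (φ : Config) (r : ℝ) :
    (φ.move U.toIsometryEquiv).count (Metric.ball 0 r) = φ.count (Metric.ball 0 r) := by
  have h : (φ.move U.toIsometryEquiv).points (Metric.ball 0 r)
      = φ.points (Metric.ball 0 r) := by
    rw [← lintegral_indicator_one measurableSet_ball, lintegral_points_move,
      ← lintegral_indicator_one measurableSet_ball]
    refine lintegral_congr fun x => ?_
    have hx : ‖U.toIsometryEquiv x‖ = ‖x‖ := U.norm_map x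
    exact indicator_apply_congr (by rw [mem_ball_zero_iff, mem_ball_zero_iff, hx]) rfl
  rw [points_apply _ measurableSet_ball, points_apply _ measurableSet_ball] at h
  exact ENat.toENNReal_inj.1 h

lemma ranked_move (hℓ : ∀ x y, ‖x‖ = ‖y‖ → ℓ x = ℓ y) (U : Plane ≃ₗᵢ[ℝ] Plane) (n : ℕ)
    (φ : Config) : ranked ℓ n (φ.move U.toIsometryEquiv) = ranked ℓ n φ := by
  rw [ranked, ranked, lintegral_points_move]
  refine lintegral_congr fun x => ?_
  have hx : ‖U.toIsometryEquiv x‖ = ‖x‖ := U.norm_map x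
  exact indicator_apply_congr
    (by rw [Set.mem_ofPred_eq, Set.mem_ofPred_eq, count_ball_move, hx]) (hℓ _ _ hx)

lemma isGeneral_move (U : Plane ≃ₗᵢ[ℝ] Plane) (φ : Config) :
    (φ.move U.toIsometryEquiv).IsGeneral ↔ φ.IsGeneral := by
  have key : ∀ (U : Plane ≃ₗᵢ[ℝ] Plane) (φ : Config), φ.IsGeneral →
      (φ.move U.toIsometryEquiv).IsGeneral := by
    intro U φ h
    refine ⟨h.infinite.image U.injective.injOn, ?_, ?_⟩
    · rintro ⟨x, hx, hx0⟩
      have : U x = 0 := hx0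
      rw [map_eq_zero_iff U U.injective] at this
      exact h.zero_notMem (this ▸ hx)
    · rintro _ ⟨x, hx, rfl⟩ _ ⟨y, hy, rfl⟩ hxy
      have hxy' : ‖U x‖ = ‖U y‖ := hxy
      rw [U.norm_map, U.norm_map] at hxy'
      rw [h.injOn_norm hx hy hxy']
  refine ⟨fun h => ?_, key U φ⟩
  have h' := key U.symm _ h
  convert h' using 1
  ext x
  rw [mem_carrier_move, mem_carrier_move]
  change x ∈ φ.carrier ↔ U.symm (U.symm.symm x) ∈ φ.carrier
  simp

lemma emptyDisk_congr {x y : Plane} (h : ‖x‖ = ‖y‖) : emptyDisk x = emptyDisk y := by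
  rw [emptyDisk, emptyDisk, h]

lemma measurableSet_emptyDisk (ζ : Plane) : MeasurableSet (emptyDisk ζ) :=
  measurable_count measurableSet_ball (measurableSet_singleton 0)

/-- For a rotation-invariant functional, the Palm expectation at a point depends only on the norm
of the point. -/
lemma ClassA.palmSum_congr_norm (hP : ClassA ν ℓ P) {x y : Plane} (h : ‖x‖ = ‖y‖)
    {F : Config → ℝ≥0∞} (hF : Measurable F)
    (hFU : ∀ (U : Plane ≃ₗᵢ[ℝ] Plane) φ, F (φ.move U.toIsometryEquiv) = F φ) :
    palmSum P x F = palmSum P y F := by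
  have := hP.isProbability
  obtain ⟨U, hU, rfl⟩ := exists_rotation h
  rw [palmSum_rotate hP.stationary hP.isotropic U hU x hF]
  simp_rw [hFU]

lemma ClassA.palmSum_emptyDisk_congr_norm (hP : ClassA ν ℓ P) {x y : Plane} (h : ‖x‖ = ‖y‖)
    {F : Config → ℝ≥0∞} (hF : Measurable F)
    (hFU : ∀ (U : Plane ≃ₗᵢ[ℝ] Plane) φ, F (φ.move U.toIsometryEquiv) = F φ) :
    palmSum P x ((emptyDisk x).indicator F) = palmSum P y ((emptyDisk y).indicator F) := by
  rw [emptyDisk_congr h]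
  refine hP.palmSum_congr_norm h (hF.indicator (measurableSet_emptyDisk y)) fun U φ => ?_
  exact indicator_apply_congr
    (by rw [emptyDisk, Set.mem_ofPred_eq, Set.mem_ofPred_eq, count_ball_move]) (hFU U φ)

lemma ClassA.palmSum_emptyDisk_ne_zero (hP : ClassA ν ℓ P) {z : Plane} (hz : z ≠ 0) :
    palmSum P z ((emptyDisk z).indicator 1) ≠ 0 := by
  obtain ⟨ζ, hζ, h⟩ := hP.emptyDisk_ne_zero ‖z‖ (norm_pos_iff.2 hz)
  rw [emptyDiskProb, palmExpect_eq] at h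
  rw [← hP.palmSum_emptyDisk_congr_norm hζ measurable_one fun _ _ => rfl]
  exact right_ne_zero_of_mul h

lemma ClassA.palmSum_emptyDisk_ne_top (hP : ClassA ν ℓ P) (z : Plane) :
    palmSum P z ((emptyDisk z).indicator 1) ≠ ∞ := by
  refine ((palmSum_mono P z ?_).trans_lt (palmSum_one P z ▸ hP.intensity_ne_top.lt_top)).ne
  exact Set.indicator_le_self' fun _ _ => bot_le

lemma ClassA.nearestExpect_eq (hP : ClassA ν ℓ P) (z : Plane) (F : Config → ℝ≥0∞) :
    nearestExpect P z F = palmSum P z ((emptyDisk z).indicator F) /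
      palmSum P z ((emptyDisk z).indicator 1) := by
  rw [nearestExpect, emptyDiskProb, palmExpect_eq, palmExpect_eq]
  exact ENNReal.mul_div_mul_left _ _ (ENNReal.inv_ne_zero.2 hP.intensity_ne_top)
    (ENNReal.inv_ne_top.2 hP.intensity_ne_zero)

/-- Palm expectations only see patterns in general position that contain the conditioning point. -/
lemma palmSum_congr_isGeneral {z : Plane}
    (hz : palmSum P z ({φ : Config | φ.IsGeneral}ᶜ.indicator 1) = 0) {F G : Config → ℝ≥0∞}
    (h : ∀ φ : Config, φ.IsGeneral → z ∈ φ.carrier → F φ = G φ) :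
    palmSum P z F = palmSum P z G := by
  have hU := measurableSet_unitSquare
  have hB : Measurable ({φ : Config | φ.IsGeneral}ᶜ.indicator (1 : Config → ℝ≥0∞)) :=
    measurable_one.indicator measurableSet_isGeneral.compl
  refine lintegral_congr_ae ?_
  filter_upwards [(lintegral_eq_zero_iff (measurable_setLIntegral_shift z hB)).1 hz] with φ hφ
  rw [setLIntegral_points _ hU, setLIntegral_points _ hU]
  rw [Pi.zero_apply, setLIntegral_points _ hU, ENNReal.tsum_eq_zero] at hφ
  refine tsum_congr fun x => h _ ?_ ?_
  · by_contra hx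
    have := hφ x
    rw [Set.indicator_of_mem (by exact hx)] at this
    exact one_ne_zero this
  · rw [mem_carrier_shift]
    simpa using x.2.1

end Rotation

/-! ### The constant as an expectation over the process and the fading -/

section Kappa

/-- The point at signed distance `y` on the first coordinate axis: a measurable choice of a point
at each distance from the origin. -/
def axisPoint (y : ℝ) : Plane := y • EuclideanSpace.single 0 (1 : ℝ)

lemma measurable_axisPoint : Measurable axisPoint := measurable_id.smul_const _

lemma norm_axisPoint {y : ℝ} (hy : 0 ≤ y) : ‖axisPoint y‖ = y := by
  simp [axisPoint, norm_smul, abs_of_nonneg hy]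

variable {ν : Measure ℝ} {ℓ : Plane → ℝ≥0∞} {P : Measure Config}

/-- A functional of the pattern seen from the origin, evaluated under the conditioning that `z` is
the nearest point and averaged over the position of the nearest point, has its plain expectation. -/
lemma ClassA.lintegral_nearest (hP : ClassA ν ℓ P) {F : Config → ℝ≥0∞} (hF : Measurable F) :
    ∫⁻ z, palmSum P z ((emptyDisk z).indicator F) = ∫⁻ φ, F φ ∂P := by
  have := hP.isProbability
  have hm : Measurable (Function.uncurry fun (z : Plane) (φ : Config) =>
      (emptyDisk z).indicator F φ) :=
    (hF.comp measurable_snd).indicator (measurable_swap (measurableSet_rank 0))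
  rw [lintegral_palmSum hP.stationary (f := fun z => (emptyDisk z).indicator F) hm]
  refine lintegral_congr_ae ?_
  filter_upwards [hP.ae_isGeneral] with φ hφ
  obtain ⟨e, he⟩ := hφ.exists_equiv
  -- The nearest point is the only point `x` of `φ` with `φ ∈ emptyDisk x`.
  refine Eq.trans ?_ (ranked_eq he (fun _ => F φ) 0)
  rfl

/-- Disintegration of an expectation with respect to the contact distance. -/
lemma ClassA.lintegral_eq_lintegral_pdf (hP : ClassA ν ℓ P) {F : Config → ℝ≥0∞}
    (hF : Measurable F)
    (hFU : ∀ (U : Plane ≃ₗᵢ[ℝ] Plane) φ, F (φ.move U.toIsometryEquiv) = F φ)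
    {ζ : ℝ → Plane} (hζ : ∀ y, 0 < y → ‖ζ y‖ = y) :
    ∫⁻ y in Set.Ioi (0 : ℝ), nearestExpect P (ζ y) F *
      pdf (fun φ : Config => φ.contactDist.toReal) P volume y = ∫⁻ φ, F φ ∂P := by
  have := hP.isProbability
  have hpdf := hP.hasPDF_contactDist
  have hmeas : ∀ {H : Config → ℝ≥0∞}, Measurable H →
      Measurable fun y => palmSum P (axisPoint y) ((emptyDisk (axisPoint y)).indicator H) := by
    intro H hH
    refine measurable_palmSum P measurable_axisPoint (f := fun y => (emptyDisk (axisPoint y)).indicator H) ?_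
    have hset : MeasurableSet {p : ℝ × Config | p.2 ∈ emptyDisk (axisPoint p.1)} :=
      (measurable_snd.prodMk (measurable_axisPoint.comp measurable_fst)) (measurableSet_rank 0)
    exact (hH.comp measurable_snd).indicator hset
  let k : ℝ → ℝ≥0∞ := fun y => palmSum P (axisPoint y) ((emptyDisk (axisPoint y)).indicator F) /
    palmSum P (axisPoint y) ((emptyDisk (axisPoint y)).indicator 1)
  have hk : Measurable k := (hmeas hF).div (hmeas measurable_one)
  have hknorm : ∀ z : Plane, k ‖z‖ = palmSum P z ((emptyDisk z).indicator F) /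
      palmSum P z ((emptyDisk z).indicator 1) := fun z => by
    have hz : ‖axisPoint ‖z‖‖ = ‖z‖ := norm_axisPoint (norm_nonneg z)
    simp only [k]
    rw [hP.palmSum_emptyDisk_congr_norm hz hF hFU,
      hP.palmSum_emptyDisk_congr_norm hz measurable_one fun _ _ => rfl]
  calc ∫⁻ y in Set.Ioi (0 : ℝ), nearestExpect P (ζ y) F *
        pdf (fun φ : Config => φ.contactDist.toReal) P volume y
      = ∫⁻ y, pdf (fun φ : Config => φ.contactDist.toReal) P volume y *
          (Set.Ioi (0 : ℝ)).indicator k y := by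
        rw [← lintegral_indicator measurableSet_Ioi]
        refine lintegral_congr fun y => ?_
        by_cases hy : 0 < y
        · have hy' : y ∈ Set.Ioi (0 : ℝ) := hy
          rw [Set.indicator_of_mem hy', Set.indicator_of_mem hy', hP.nearestExpect_eq, ← hknorm,
            hζ y hy, mul_comm]
        · have hy' : y ∉ Set.Ioi (0 : ℝ) := hy
          rw [Set.indicator_of_notMem hy', Set.indicator_of_notMem hy', mul_zero]
    _ = ∫⁻ φ : Config, (Set.Ioi (0 : ℝ)).indicator k φ.contactDist.toReal ∂P :=
        pdf.lintegral_pdf_mul (hk.indicator measurableSet_Ioi).aemeasurable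
    _ = ∫⁻ φ, ranked (fun z => k ‖z‖) 0 φ ∂P := by
        refine lintegral_congr_ae ?_
        filter_upwards [hP.ae_isGeneral] with φ hφ
        obtain ⟨e, he⟩ := hφ.exists_equiv
        have h0 : 0 < ‖(e 0 : Plane)‖ :=
          norm_pos_iff.2 fun h0 => hφ.zero_notMem (h0 ▸ (e 0).2)
        rw [contactDist_toReal_eq he, ranked_eq he, Set.indicator_of_mem (by exact h0)]
    -- The Campbell–Mecke formula for the sum whose only term is the nearest point.
    _ = ∫⁻ z, k ‖z‖ * palmSum P z ((emptyDisk z).indicator 1) := by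
        have hset : MeasurableSet {p : Plane × Config | p.2.count (Metric.ball 0 ‖p.1‖) = (0 : ℕ)} :=
          measurable_swap (measurableSet_rank 0)
        have hmk : Measurable (Function.uncurry fun (z : Plane) (φ : Config) =>
            {z : Plane | φ.count (Metric.ball 0 ‖z‖) = (0 : ℕ)}.indicator (fun z => k ‖z‖) z) :=
          (hk.comp (measurable_norm.comp measurable_fst)).indicator hset
        refine (lintegral_palmSum hP.stationary hmk).symm.trans ?_
        refine lintegral_congr fun z => ?_
        have hE : Measurable ((emptyDisk z).indicator (1 : Config → ℝ≥0∞)) :=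
          measurable_one.indicator (measurableSet_emptyDisk z)
        rw [← palmSum_const_mul P z _ hE]
        congr 1
        funext φ
        by_cases hφ : φ ∈ emptyDisk z
        · rw [Set.indicator_of_mem hφ, Set.indicator_of_mem (by exact hφ), Pi.one_apply, mul_one]
        · rw [Set.indicator_of_notMem hφ, Set.indicator_of_notMem (by exact hφ), mul_zero]
    _ = ∫⁻ z, palmSum P z ((emptyDisk z).indicator F) := by
        refine lintegral_congr_ae ?_
        have : ∀ᵐ z : Plane, z ≠ 0 := by simp [ae_iff]
        filter_upwards [this] with z hz
        rw [hknorm, ENNReal.div_mul_cancel (hP.palmSum_emptyDisk_ne_zero hz)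
          (hP.palmSum_emptyDisk_ne_top z)]
    _ = ∫⁻ φ, F φ ∂P := hP.lintegral_nearest hF

lemma pathLoss_congr {α : ℝ} (hℓ : ℓ = nonsingularPathLoss α ∨ ℓ = singularPathLoss α)
    {x y : Plane} (h : ‖x‖ = ‖y‖) : ℓ x = ℓ y := by
  have h' : ‖x‖ₑ = ‖y‖ₑ := by rw [← ofReal_norm, ← ofReal_norm, h]
  rcases hℓ with rfl | rfl <;> simp [nonsingularPathLoss, singularPathLoss, h']

/-- If `z` is the nearest point, the expectation over the fading in the definition of `kappa` is
computed along the enumeration of the pattern. -/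
lemma lintegral_fadingLaw_eq_interferenceRatio (ν : Measure ℝ) [IsProbabilityMeasure ν]
    (ℓ : Plane → ℝ≥0∞) (W : ℝ≥0) (a : ℝ) {m : ℝ} (hm : 0 < m) {φ : Config} (hφ : φ.IsGeneral)
    {z : Plane} (hz : z ∈ φ.carrier) (hE : φ ∈ emptyDisk z) :
    ∫⁻ h, ENNReal.ofReal a * ℓ z ^ (-m) * (interference ℓ φ z 0 h + W) ^ m ∂fadingLaw ν φ
      = ∫⁻ h, ENNReal.ofReal a * interferenceRatio ℓ W φ h ^ m ∂markLaw ν := by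
  obtain ⟨e, he⟩ := hφ.exists_equiv
  obtain rfl : z = e 0 := (rank_eq_iff he hz 0).1 hE
  have hG : Measurable (Function.uncurry fun (_ : ℝ) (I : ℝ≥0∞) =>
      ENNReal.ofReal a * ℓ (e 0) ^ (-m) * (I + W) ^ m) :=
    ((measurable_snd.add_const _).pow_const m).const_mul _
  refine (lintegral_fadingLaw ν ℓ he hG).trans ?_
  rw [lintegral_const, measure_univ, mul_one]
  refine lintegral_congr fun h => ?_
  rw [interferenceRatio, ranked_eq he, ENNReal.div_rpow_of_nonneg _ _ hm.le, ENNReal.rpow_neg,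
    div_eq_mul_inv, mul_assoc, mul_comm (_ ^ m)⁻¹]

/-- The constant `kappa` is the expectation of the `m`-th power of the ratio of interference and
noise to the mean signal of the nearest point, up to the factor `a`. -/
theorem ClassA.kappa_eq [IsProbabilityMeasure ν] (hP : ClassA ν ℓ P) {α : ℝ}
    (hℓ : ℓ = nonsingularPathLoss α ∨ ℓ = singularPathLoss α) (W : ℝ≥0) (a : ℝ) {m : ℝ}
    (hm : 0 < m) {ζ : ℝ → Plane} (hζ : ∀ y, 0 < y → ‖ζ y‖ = y) :
    kappa P ν ℓ W a m ζ
      = ∫⁻ φ, ∫⁻ h, ENNReal.ofReal a * interferenceRatio ℓ W φ h ^ m ∂markLaw ν ∂P := by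
  have := hP.isProbability
  have hpdf := hP.hasPDF_contactDist
  let F : Config → ℝ≥0∞ := fun φ =>
    ∫⁻ h, ENNReal.ofReal a * interferenceRatio ℓ W φ h ^ m ∂markLaw ν
  have hF : Measurable F := Measurable.lintegral_prod_right'
    (f := fun p : Config × (ℕ → ℝ) => ENNReal.ofReal a * interferenceRatio ℓ W p.1 p.2 ^ m)
    (((measurable_interferenceRatio (measurable_pathLoss hℓ) W).pow_const m).const_mul _)
  have hFU : ∀ (U : Plane ≃ₗᵢ[ℝ] Plane) φ, F (φ.move U.toIsometryEquiv) = F φ := fun U φ => by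
    simp only [F, interferenceRatio, rankedInterference,
      ranked_move (fun x y h => pathLoss_congr hℓ h) U]
  let B : Config → ℝ≥0∞ := {φ : Config | φ.IsGeneral}ᶜ.indicator 1
  have hB : Measurable B := measurable_one.indicator measurableSet_isGeneral.compl
  have hBU : ∀ (U : Plane ≃ₗᵢ[ℝ] Plane) φ, B (φ.move U.toIsometryEquiv) = B φ := fun U φ =>
    indicator_apply_congr (not_congr (isGeneral_move U φ)) rfl
  -- The radii at which the Palm distribution charges patterns not in general position.
  let N : Set ℝ := {y | palmSum P (axisPoint y) B ≠ 0}
  have hN : MeasurableSet N :=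
    (measurable_palmSum P measurable_axisPoint (f := fun _ => B) (hB.comp measurable_snd)
      (measurableSet_singleton 0)).compl
  have hN0 : P {φ | φ.contactDist.toReal ∈ N} = 0 := by
    refine hP.measure_contactDist_mem_eq_zero hN ?_
    rw [measure_eq_zero_iff_ae_notMem]
    filter_upwards [hP.ae_palmSum_not_isGeneral] with z hz hzN
    refine hzN ?_
    rw [hP.palmSum_congr_norm (norm_axisPoint (norm_nonneg z)) hB hBU]
    exact hz
  -- The law of the contact distance does not charge `N`, so `N` is negligible where the density is
  -- positive; no other radii contribute to `kappa`.
  have hae : ∀ᵐ y : ℝ, pdf (fun φ : Config => φ.contactDist.toReal) P volume y ≠ 0 → y ∉ N := by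
    rw [← ae_withDensity_iff (measurable_pdf _ _ _), ← map_eq_withDensity_pdf (fun φ : Config => φ.contactDist.toReal) P volume,
      ← measure_eq_zero_iff_ae_notMem,
      Measure.map_apply measurable_contactDist.ennreal_toReal hN]
    exact hN0
  rw [← hP.lintegral_eq_lintegral_pdf hF hFU hζ, kappa]
  refine lintegral_congr_ae ?_
  filter_upwards [ae_restrict_of_ae hae, ae_restrict_mem measurableSet_Ioi] with y hy hy0
  by_cases hpy : pdf (fun φ : Config => φ.contactDist.toReal) P volume y = 0
  · simp only [hpy, mul_zero]
  · have hyB : palmSum P (ζ y) B = 0 := by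
      rw [hP.palmSum_congr_norm ((hζ y hy0).trans (norm_axisPoint (le_of_lt hy0)).symm) hB hBU]
      simpa [N] using hy hpy
    rw [hP.nearestExpect_eq, hP.nearestExpect_eq]
    congr 2
    refine palmSum_congr_isGeneral hyB fun φ hφ hz => ?_
    by_cases hE : φ ∈ emptyDisk (ζ y)
    · rw [Set.indicator_of_mem hE, Set.indicator_of_mem hE]
      exact lintegral_fadingLaw_eq_interferenceRatio ν ℓ W a hm hφ hz hE
    · rw [Set.indicator_of_notMem hE, Set.indicator_of_notMem hE]

end Kappa

/-! ### The fading distribution near zero -/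

section Fading

variable {ν : Measure ℝ} {a m : ℝ}

lemma tendsto_cdf_div_rpow (hcdf : (fun t : ℝ => cdf ν t) ~[𝓝[>] 0] fun t => a * t ^ m) :
    Tendsto (fun t => cdf ν t / t ^ m) (𝓝[>] 0) (𝓝 a) := by
  rcases eq_or_ne a 0 with rfl | ha
  · simp only [zero_mul] at hcdf
    refine tendsto_const_nhds.congr' ?_
    filter_upwards [isEquivalent_zero_iff_eventually_zero.1 hcdf] with t ht
    simp [show cdf ν t = 0 from ht]
  have hne : ∀ᶠ t : ℝ in 𝓝[>] 0, a * t ^ m ≠ 0 := by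
    filter_upwards [self_mem_nhdsWithin] with t (ht : 0 < t)
    exact mul_ne_zero ha (Real.rpow_pos_of_pos ht m).ne'
  have h := ((isEquivalent_iff_tendsto_one hne).1 hcdf).const_mul a
  rw [mul_one] at h
  refine h.congr' ?_
  filter_upwards [hne] with t ht
  have := right_ne_zero_of_mul ht
  simp only [Pi.div_apply]
  field_simp

lemma exists_cdf_le (hm : 0 < m) (hcdf : (fun t : ℝ => cdf ν t) ~[𝓝[>] 0] fun t => a * t ^ m) :
    ∃ C : ℝ, 0 ≤ C ∧ ∀ t, 0 < t → cdf ν t ≤ C * t ^ m := by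
  have h := (tendsto_cdf_div_rpow hcdf).eventually_lt_const (lt_add_one a)
  obtain ⟨δ, hδ, hlt⟩ := mem_nhdsGT_iff_exists_Ioo_subset.1 h
  have hδ : 0 < δ := hδ
  refine ⟨max (a + 1) (δ ^ m)⁻¹, le_max_of_le_right (by positivity), fun t ht => ?_⟩
  have htm : 0 < t ^ m := Real.rpow_pos_of_pos ht m
  rcases lt_or_ge t δ with h | h
  · have : cdf ν t / t ^ m < a + 1 := hlt ⟨ht, h⟩
    rw [div_lt_iff₀ htm] at this
    exact this.le.trans (by gcongr; exact le_max_left _ _)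
  · have hδm : 0 < δ ^ m := Real.rpow_pos_of_pos hδ m
    calc cdf ν t ≤ 1 := cdf_le_one ν t
      _ = (δ ^ m)⁻¹ * δ ^ m := (inv_mul_cancel₀ hδm.ne').symm
      _ ≤ (δ ^ m)⁻¹ * t ^ m := by gcongr
      _ ≤ _ := by gcongr; exact le_max_right _ _

lemma ae_fading_pos [IsProbabilityMeasure ν] (hm : 0 < m) (hcdf : (fun t : ℝ => cdf ν t) ~[𝓝[>] 0] fun t => a * t ^ m) :
    ∀ᵐ t ∂ν, 0 < t := by
  obtain ⟨C, -, hC⟩ := exists_cdf_le hm hcdf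
  have hlim : Tendsto (fun t : ℝ => C * t ^ m) (𝓝[>] 0) (𝓝 0) := by
    have h : Tendsto (fun t : ℝ => C * t ^ m) (𝓝 0) (𝓝 (C * 0 ^ m)) :=
      ((Real.continuousAt_rpow_const 0 m (Or.inr hm.le)).tendsto).const_mul C
    rw [Real.zero_rpow hm.ne', mul_zero] at h
    exact h.mono_left nhdsWithin_le_nhds
  have h0 : cdf ν 0 ≤ 0 := by
    refine ge_of_tendsto hlim ?_
    filter_upwards [self_mem_nhdsWithin] with t (ht : 0 < t)
    exact (monotone_cdf ν ht.le).trans (hC t ht)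
  have hν : ν (Set.Iic 0) = 0 := by
    rw [← ofReal_cdf]
    exact ENNReal.ofReal_eq_zero.2 h0
  filter_upwards [measure_eq_zero_iff_ae_notMem.1 hν] with t ht
  simpa using ht

end Fading

/-! ### The outage probability -/

section Outage

variable {ν : Measure ℝ} [IsProbabilityMeasure ν] {α a m : ℝ} {ℓ : Plane → ℝ≥0∞} {W : ℝ≥0}
  {P : Measure Config}

lemma measurable_interference (ℓ : Plane → ℝ≥0∞) (φ : Config) (u : Plane) (r : ℝ) :
    Measurable (interference ℓ φ u r) := by
  classical
  refine Measurable.tsum fun x => ?_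
  split_ifs
  · exact (ENNReal.measurable_ofReal.comp (measurable_pi_apply x)).mul_const _
  · exact measurable_const

lemma interferenceRatio_pos (hα : 0 < α)
    (hℓ : ℓ = nonsingularPathLoss α ∨ ℓ = singularPathLoss α) {φ : Config} (hφ : φ.IsGeneral)
    {h : ℕ → ℝ} (h0 : 0 < h 0) : 0 < interferenceRatio ℓ W φ h := by
  obtain ⟨e, he⟩ := hφ.exists_equiv
  have hne : ∀ n, (e n : Plane) ≠ 0 := fun n h0 => hφ.zero_notMem (h0 ▸ (e n).2)
  have hI : rankedInterference ℓ φ h ≠ 0 := by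
    rw [rankedInterference, Ne, ENNReal.tsum_eq_zero, not_forall]
    refine ⟨0, mul_ne_zero (ENNReal.ofReal_pos.2 h0).ne' ?_⟩
    rw [ranked_eq he]
    exact pathLoss_ne_zero hα hℓ (hne _)
  rw [interferenceRatio, ranked_eq he]
  refine ENNReal.div_pos (fun h => hI (add_eq_zero.1 h).1) (pathLoss_ne_top hα hℓ (hne 0))

/-- Almost surely the ratio is neither `0` nor `∞`, so that no conventions of division in `ℝ≥0∞`
intervene. -/
lemma ClassA.ae_interferenceRatio (hP : ClassA ν ℓ P) (hα : 2 < α)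
    (hℓ : ℓ = nonsingularPathLoss α ∨ ℓ = singularPathLoss α) (W : ℝ≥0) (hm : 0 < m)
    (hcdf : (fun t : ℝ => cdf ν t) ~[𝓝[>] 0] fun t => a * t ^ m)
    (hmom : ∀ n : ℕ, Integrable (fun t : ℝ => t ^ n) ν) :
    ∀ᵐ p ∂P.prod (markLaw ν), p.1.IsGeneral ∧ interferenceRatio ℓ W p.1 p.2 ≠ 0 ∧
      interferenceRatio ℓ W p.1 p.2 ≠ ∞ := by
  have := hP.isProbability
  have hR := measurable_interferenceRatio (measurable_pathLoss hℓ) W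
  have h1 : ∀ᵐ p ∂P.prod (markLaw ν), p.1.IsGeneral :=
    Measure.quasiMeasurePreserving_fst.ae hP.ae_isGeneral
  have h2 : ∀ᵐ p ∂P.prod (markLaw ν), 0 < p.2 0 :=
    Measure.quasiMeasurePreserving_snd.ae
      ((measurePreserving_eval_infinitePi (fun _ : ℕ => ν) 0).quasiMeasurePreserving.ae
        (ae_fading_pos hm hcdf))
  have h3 : ∫⁻ p, interferenceRatio ℓ W p.1 p.2 ^ m ∂P.prod (markLaw ν) < ∞ := by
    rw [lintegral_prod _ (hR.pow_const m).aemeasurable]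
    exact hP.lintegral_interferenceRatio_rpow_lt_top hα hℓ W hmom hm
  filter_upwards [h1, h2, ae_lt_top (hR.pow_const m) h3.ne] with p hp1 hp2 hp3
  refine ⟨hp1, (interferenceRatio_pos (by linarith) hℓ hp1 hp2).ne', fun htop => ?_⟩
  rw [htop, ENNReal.top_rpow_of_pos hm] at hp3
  exact hp3.ne rfl

/-- Service succeeds if and only if the fading of the nearest point exceeds a threshold that is
independent of it. -/
lemma lt_div_iff_lt_fading {θ : ℝ} (hθ : 0 < θ) {t : ℝ} {L I : ℝ≥0∞} (hL0 : L ≠ 0)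
    (hL : L ≠ ∞) (hR0 : (I + W) / L ≠ 0) (hR : (I + W) / L ≠ ∞) :
    ENNReal.ofReal θ < ENNReal.ofReal t * L / (W + I) ↔ θ * ((I + W) / L).toReal < t := by
  have hX0 : (W : ℝ≥0∞) + I ≠ 0 := fun h => hR0 (by rw [add_comm, h, ENNReal.zero_div])
  have hX : (W : ℝ≥0∞) + I ≠ ∞ := fun h => hR (by rw [add_comm, h, ENNReal.top_div_of_ne_top hL])
  rw [ENNReal.lt_div_iff_mul_lt (Or.inl hX0) (Or.inl hX),
    ← ENNReal.div_lt_iff (Or.inl hL0) (Or.inl hL), mul_div_assoc, add_comm (W : ℝ≥0∞) I,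
    ← ENNReal.ofReal_toReal hR, ← ENNReal.ofReal_mul hθ.le,
    ENNReal.toReal_ofReal ENNReal.toReal_nonneg]
  exact ENNReal.ofReal_lt_ofReal_iff_of_nonneg (by positivity)

/-- The success probability, with the fading of the nearest point integrated out. -/
lemma ClassA.successProb_eq (hP : ClassA ν ℓ P) (hα : 2 < α)
    (hℓ : ℓ = nonsingularPathLoss α ∨ ℓ = singularPathLoss α) (hm : 0 < m)
    (hcdf : (fun t : ℝ => cdf ν t) ~[𝓝[>] 0] fun t => a * t ^ m)
    (hmom : ∀ n : ℕ, Integrable (fun t : ℝ => t ^ n) ν) {θ : ℝ} (hθ : 0 < θ) :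
    successProb P ν ℓ W θ = ∫⁻ p, ν (Set.Ioi (θ * (interferenceRatio ℓ W p.1 p.2).toReal))
      ∂P.prod (markLaw ν) := by
  have := hP.isProbability
  have hR := measurable_interferenceRatio (measurable_pathLoss hℓ) W
  have hanti : Antitone fun x : ℝ => ν (Set.Ioi x) := fun x y h =>
    measure_mono (Set.Ioi_subset_Ioi h)
  have hmeas : Measurable fun p : Config × (ℕ → ℝ) =>
      ν (Set.Ioi (θ * (interferenceRatio ℓ W p.1 p.2).toReal)) :=
    hanti.measurable.comp (hR.ennreal_toReal.const_mul θ)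
  rw [lintegral_prod _ hmeas.aemeasurable, successProb]
  refine lintegral_congr_ae ?_
  filter_upwards [hP.ae_isGeneral,
    Measure.ae_ae_of_ae_prod (hP.ae_interferenceRatio hα hℓ W hm hcdf hmom)] with φ hφ hφR
  obtain ⟨e, he⟩ := hφ.exists_equiv
  have hu : (e 0 : Plane) ≠ 0 := fun h0 => hφ.zero_notMem (h0 ▸ (e 0).2)
  rw [nearest_eq hφ he, tsum_singleton (e 0)
    fun u => fadingLaw ν φ {h | ENNReal.ofReal θ < sinr ℓ W φ u h}, Set.encard_singleton]
  simp only [ENat.toENNReal_one, div_one]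
  let A : Set (ℝ × ℝ≥0∞) :=
    {q | ENNReal.ofReal θ < ENNReal.ofReal q.1 * ℓ (e 0) / (W + q.2)}
  have hA : MeasurableSet A := measurableSet_lt measurable_const
    (((ENNReal.measurable_ofReal.comp measurable_fst).mul_const _).div
      (measurable_snd.const_add _))
  have hpair : Measurable fun h : φ.carrier → ℝ => (h (e 0), interference ℓ φ (e 0) 0 h) :=
    (measurable_pi_apply _).prodMk (measurable_interference ℓ φ _ _)
  have hset : MeasurableSet {h : φ.carrier → ℝ | ENNReal.ofReal θ < sinr ℓ W φ (e 0) h} :=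
    hpair hA
  rw [← lintegral_indicator_one hset]
  have hfad := lintegral_fadingLaw ν ℓ he (G := fun t I => A.indicator 1 (t, I))
    (measurable_one.indicator hA)
  refine Eq.trans hfad ?_
  have hpair' : Measurable fun q : ℝ × (ℕ → ℝ) => (q.1, rankedInterference ℓ φ q.2) :=
    measurable_fst.prodMk ((measurable_rankedInterference_right ℓ φ).comp measurable_snd)
  have hAm : Measurable fun q : ℝ × (ℕ → ℝ) =>
      A.indicator (1 : ℝ × ℝ≥0∞ → ℝ≥0∞) (q.1, rankedInterference ℓ φ q.2) :=
    (measurable_one.indicator hA).comp hpair'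
  have hswap := lintegral_lintegral_swap (μ := ν) (ν := markLaw ν)
    (f := fun t h => A.indicator (1 : ℝ × ℝ≥0∞ → ℝ≥0∞) (t, rankedInterference ℓ φ h))
    hAm.aemeasurable
  -- Integrate over the fading `t` of the nearest point first.
  refine hswap.trans (lintegral_congr_ae ?_)
  filter_upwards [hφR] with h hh
  have hAh : MeasurableSet {t : ℝ | (t, rankedInterference ℓ φ h) ∈ A} :=
    measurable_prodMk_right hA
  refine (lintegral_indicator_one hAh).trans ?_
  congr 1
  ext t
  have h2 := hh.2
  rw [interferenceRatio, ranked_eq he] at h2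
  refine (lt_div_iff_lt_fading hθ (pathLoss_ne_zero (by linarith) hℓ hu)
    (pathLoss_ne_top (by linarith) hℓ hu) h2.1 h2.2).trans ?_
  rw [Set.mem_Ioi, interferenceRatio, ranked_eq he]

lemma ClassA.one_sub_successProb (hP : ClassA ν ℓ P) (hα : 2 < α)
    (hℓ : ℓ = nonsingularPathLoss α ∨ ℓ = singularPathLoss α) (hm : 0 < m)
    (hcdf : (fun t : ℝ => cdf ν t) ~[𝓝[>] 0] fun t => a * t ^ m)
    (hmom : ∀ n : ℕ, Integrable (fun t : ℝ => t ^ n) ν) {θ : ℝ} (hθ : 0 < θ) :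
    1 - (successProb P ν ℓ W θ).toReal =
      (∫⁻ p, ν (Set.Iic (θ * (interferenceRatio ℓ W p.1 p.2).toReal))
        ∂P.prod (markLaw ν)).toReal := by
  have := hP.isProbability
  have hR := measurable_interferenceRatio (measurable_pathLoss hℓ) W
  have hmono : Monotone fun x : ℝ => ν (Set.Iic x) := fun x y h =>
    measure_mono (Set.Iic_subset_Iic.2 h)
  have hmeas : Measurable fun p : Config × (ℕ → ℝ) =>
      ν (Set.Iic (θ * (interferenceRatio ℓ W p.1 p.2).toReal)) :=
    hmono.measurable.comp (hR.ennreal_toReal.const_mul θ)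
  have hle : ∀ s : Config × (ℕ → ℝ) → Set ℝ, ∫⁻ p, ν (s p) ∂P.prod (markLaw ν) ≠ ∞ := fun s =>
    ((lintegral_mono fun p => prob_le_one).trans_lt
      (by simp : ∫⁻ _p, (1 : ℝ≥0∞) ∂P.prod (markLaw ν) < ∞)).ne
  have hsum : (∫⁻ p, ν (Set.Iic (θ * (interferenceRatio ℓ W p.1 p.2).toReal))
      ∂P.prod (markLaw ν)) + successProb P ν ℓ W θ = 1 := by
    rw [hP.successProb_eq hα hℓ hm hcdf hmom hθ, ← lintegral_add_left hmeas]
    have : ∀ x : ℝ, ν (Set.Iic x) + ν (Set.Ioi x) = 1 := fun x => by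
      rw [← Set.compl_Iic, measure_add_measure_compl measurableSet_Iic, measure_univ]
    simp [this]
  have hs : successProb P ν ℓ W θ ≠ ∞ := by
    rw [hP.successProb_eq hα hℓ hm hcdf hmom hθ]
    exact hle _
  have h := congrArg ENNReal.toReal hsum
  rw [ENNReal.toReal_add (hle _) hs, ENNReal.toReal_one] at h
  linarith

/-- The asymptotics of the outage probability, by dominated convergence. -/
lemma ClassA.tendsto_outage (hP : ClassA ν ℓ P) (hα : 2 < α)
    (hℓ : ℓ = nonsingularPathLoss α ∨ ℓ = singularPathLoss α) (ha : 0 < a) (hm : 0 < m)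
    (hcdf : (fun t : ℝ => cdf ν t) ~[𝓝[>] 0] fun t => a * t ^ m)
    (hmom : ∀ n : ℕ, Integrable (fun t : ℝ => t ^ n) ν) :
    Tendsto (fun θ : ℝ => ∫⁻ p, ν (Set.Iic (θ * (interferenceRatio ℓ W p.1 p.2).toReal)) /
        ENNReal.ofReal (θ ^ m) ∂P.prod (markLaw ν)) (𝓝[>] 0)
      (𝓝 (∫⁻ p, ENNReal.ofReal a * interferenceRatio ℓ W p.1 p.2 ^ m ∂P.prod (markLaw ν))) := by
  have := hP.isProbability
  have hR := measurable_interferenceRatio (measurable_pathLoss hℓ) W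
  have hmono : Monotone fun x : ℝ => ν (Set.Iic x) := fun x y h =>
    measure_mono (Set.Iic_subset_Iic.2 h)
  obtain ⟨C, hC0, hC⟩ := exists_cdf_le hm hcdf
  have hreal : ∀ {R : ℝ≥0∞} {θ : ℝ}, 0 < θ →
      ν (Set.Iic (θ * R.toReal)) / ENNReal.ofReal (θ ^ m)
        = ENNReal.ofReal (cdf ν (θ * R.toReal) / θ ^ m) := fun {R θ} hθ => by
    rw [← ofReal_cdf, ENNReal.ofReal_div_of_pos (Real.rpow_pos_of_pos hθ m)]
  have hpow : ∀ {R : ℝ≥0∞} (c : ℝ), 0 ≤ c → R ≠ ∞ →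
      ENNReal.ofReal c * R ^ m = ENNReal.ofReal (c * R.toReal ^ m) := fun {R} c hc hRt => by
    rw [ENNReal.ofReal_mul hc, ← ENNReal.ofReal_rpow_of_nonneg ENNReal.toReal_nonneg hm.le,
      ENNReal.ofReal_toReal hRt]
  refine tendsto_lintegral_filter_of_dominated_convergence
    (fun p => ENNReal.ofReal C * interferenceRatio ℓ W p.1 p.2 ^ m) ?_ ?_ ?_ ?_
  · exact Eventually.of_forall fun θ =>
      (hmono.measurable.comp (hR.ennreal_toReal.const_mul θ)).div_const _
  · filter_upwards [self_mem_nhdsWithin] with θ (hθ : 0 < θ)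
    filter_upwards [hP.ae_interferenceRatio hα hℓ W hm hcdf hmom] with p hp
    have hr : 0 < (interferenceRatio ℓ W p.1 p.2).toReal := ENNReal.toReal_pos hp.2.1 hp.2.2
    rw [hreal hθ, hpow C hC0 hp.2.2]
    refine ENNReal.ofReal_le_ofReal ?_
    rw [div_le_iff₀ (Real.rpow_pos_of_pos hθ m)]
    refine (hC _ (mul_pos hθ hr)).trans_eq ?_
    rw [Real.mul_rpow hθ.le hr.le]
    ring
  · rw [lintegral_const_mul _ (hR.pow_const m), lintegral_prod _ (hR.pow_const m).aemeasurable]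
    exact ENNReal.mul_ne_top ENNReal.ofReal_ne_top
      (hP.lintegral_interferenceRatio_rpow_lt_top hα hℓ W hmom hm).ne
  · filter_upwards [hP.ae_interferenceRatio hα hℓ W hm hcdf hmom] with p hp
    have hr : 0 < (interferenceRatio ℓ W p.1 p.2).toReal := ENNReal.toReal_pos hp.2.1 hp.2.2
    rw [hpow a ha.le hp.2.2]
    set r := (interferenceRatio ℓ W p.1 p.2).toReal with hrdef
    have hscale : Tendsto (fun θ : ℝ => θ * r) (𝓝[>] 0) (𝓝[>] 0) := by
      refine tendsto_nhdsWithin_iff.2 ⟨?_, ?_⟩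
      · have : Tendsto (fun θ : ℝ => θ * r) (𝓝 0) (𝓝 (0 * r)) := tendsto_id.mul_const r
        rw [zero_mul] at this
        exact this.mono_left nhdsWithin_le_nhds
      · filter_upwards [self_mem_nhdsWithin] with θ (hθ : 0 < θ)
        exact mul_pos hθ hr
    have hlim := ((tendsto_cdf_div_rpow hcdf).comp hscale).mul_const (r ^ m)
    refine (ENNReal.tendsto_ofReal hlim).congr' ?_
    filter_upwards [self_mem_nhdsWithin] with θ (hθ : 0 < θ)
    rw [hreal hθ, ← hrdef]
    congr 1
    have h1 := (Real.rpow_pos_of_pos hθ m).ne'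
    have h2 := (Real.rpow_pos_of_pos hr m).ne'
    simp only [Function.comp_apply]
    rw [Real.mul_rpow hθ.le hr.le]
    field_simp

end Outage

end Cellular

end

open Cellular in
theorem theorem1
    -- the path loss model, singular or non-singular, and the noise power
    (α : ℝ) (hα : 2 < α) (ℓ : Plane → ℝ≥0∞)
    (hℓ : ℓ = nonsingularPathLoss α ∨ ℓ = singularPathLoss α) (W : ℝ≥0)
    -- the fading law
    (ν : Measure ℝ) [IsProbabilityMeasure ν] (a m : ℝ) (ha : 0 < a) (hm : 0 < m)
    (hcdf : (fun t : ℝ => cdf ν t) ~[𝓝[>] 0] fun t => a * t ^ m)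
    (hmom : ∀ n : ℕ, Integrable (fun t : ℝ => t ^ n) ν)
    -- the law of the point process
    (P : Measure Config) (hP : ClassA ν ℓ P)
    -- a point at each distance from the origin
    (ζ : ℝ → Plane) (hζ : ∀ y, 0 < y → ‖ζ y‖ = y) :
    HasPDF (fun φ : Config => φ.contactDist.toReal) P volume ∧
    0 < kappa P ν ℓ W a m ζ ∧ kappa P ν ℓ W a m ζ < ∞ ∧
    Tendsto (fun θ : ℝ => (1 - (successProb P ν ℓ W θ).toReal) / θ ^ m) (𝓝[>] 0)
      (𝓝 (kappa P ν ℓ W a m ζ).toReal) := by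
  have := hP.isProbability
  have hR := measurable_interferenceRatio (measurable_pathLoss hℓ) W
  have hκ : kappa P ν ℓ W a m ζ =
      ∫⁻ p, ENNReal.ofReal a * interferenceRatio ℓ W p.1 p.2 ^ m ∂P.prod (markLaw ν) := by
    rw [hP.kappa_eq hℓ W a hm hζ, lintegral_prod _ ((hR.pow_const m).const_mul _).aemeasurable]
  have hfin : kappa P ν ℓ W a m ζ < ∞ := by
    rw [hκ, lintegral_const_mul _ (hR.pow_const m), lintegral_prod _ (hR.pow_const m).aemeasurable]
    exact ENNReal.mul_lt_top ENNReal.ofReal_lt_top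
      (hP.lintegral_interferenceRatio_rpow_lt_top hα hℓ W hmom hm)
  have hae := hP.ae_interferenceRatio hα hℓ W hm hcdf hmom
  refine ⟨hP.hasPDF_contactDist, ?_, hfin, ?_⟩
  · refine pos_iff_ne_zero.2 fun h0 => ?_
    rw [hκ, lintegral_eq_zero_iff ((hR.pow_const m).const_mul _)] at h0
    have hfalse : ∀ᵐ p ∂P.prod (markLaw ν), False := by
      filter_upwards [h0, hae] with p hp0 hp
      refine mul_ne_zero (ENNReal.ofReal_pos.2 ha).ne' ?_ hp0
      exact (ENNReal.rpow_pos (pos_iff_ne_zero.2 hp.2.1) hp.2.2).ne'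
    exact (ae_neBot.2 (IsProbabilityMeasure.ne_zero (P.prod (markLaw ν)))).ne
      (eventually_false_iff_eq_bot.1 hfalse)
  · have hlim := hP.tendsto_outage (W := W) hα hℓ ha hm hcdf hmom
    rw [← hκ] at hlim
    refine ((ENNReal.tendsto_toReal hfin.ne).comp hlim).congr' ?_
    filter_upwards [self_mem_nhdsWithin] with θ (hθ : 0 < θ)
    have hθm : 0 < θ ^ m := Real.rpow_pos_of_pos hθ m
    rw [Function.comp_apply, hP.one_sub_successProb hα hℓ hm hcdf hmom hθ]
    simp_rw [div_eq_mul_inv]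
    rw [lintegral_mul_const' _ _ (ENNReal.inv_ne_top.2 (ENNReal.ofReal_pos.2 hθm).ne'),
      ENNReal.toReal_mul, ENNReal.toReal_inv, ENNReal.toReal_ofReal hθm.le]
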